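/- Let $n\ge 1$ and $\Omega=(0,1)^n\subseteq\mathbb R^n$. For $f\in L^1(\Omega)$ and $A\subseteq\Omega$ open put $$|\mathrm D^2f|(A)=\sup_F\int_A\sum_{i,j=1}^n f\,\partial_i\partial_jF_{i,j}\,\mathrm d x,$$ the supremum being over all $F\in C_c^\infty(A)^{n\times n}$ such that the largest singular value of the matrix $F(x)$ is at most $1$ for every $x$. Let $\mathcal A\subseteq L^1(\Omega)$ be the subspace of affine functions and $\pi:L^1(\Omega)\to L^1(\Omega)/\mathcal A$ the canonical projection. The quantity $|\mathrm D^2f|(A)$ depends only on $\pi(f)$, so it is defined for classes $q\in L^1(\Omega)/\mathcal A$; if $|\mathrm D^2q|(\Omega)<\infty$, then $A\mapsto|\mathrm D^2q|(A)$ is the restriction to open sets of a finite Borel measure on $\Omega$, whose support $\operatorname{supp}(|\mathrm D^2q|)$ is the set of all $x\in\Omega$ such that $|\mathrm D^2q|(A)>0$ for every open $A\subseteq\Omega$ containing $x$. Set $$\mathcal B=\{q\in L^1(\Omega)/\mathcal A:|\mathrm D^2q|(\Omega)\le1\},\qquad \mathcal S=\{q\in L^1(\Omega)/\mathcal A:|\mathrm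 D^2q|(\Omega)=1\}.$$ A continuous function $f:\Omega\to\mathbb R$ belongs to $\mathrm{CPWL}(\Omega)$ if there is a family $\{P_k\}$ of $n$-dimensional convex polytopes (convex hulls of finitely many points) with union $\mathbb R^n$, intersecting only at their boundaries, such that $f|_{P_k\cap\Omega}$ is affine for every $k$ and every ball meets only finitely many $P_k$. Let $\mathcal E=\pi(\mathrm{CPWL}(\Omega))\cap\operatorname{ext}(\mathcal B)$, where $\operatorname{ext}(\mathcal B)$ is the set of extreme points of $\mathcal B$. Proposition 5.1 (CPWL extreme points). Let $g\in\pi(\mathrm{CPWL}(\Omega))\cap\mathcal S$. Then $g\in\mathcal E$ if and only if $h\in\operatorname{span}(g)$ for every $h\in\mathcal B$ with $\operatorname{supp}(|\mathrm D^2h|)\subseteq\operatorname{supp}(|\mathrm D^2g|)$. -/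

import Mathlib

open MeasureTheory Set Topology
open scoped ENNReal ContDiff

noncomputable section

namespace HTV

/-- Euclidean space `ℝⁿ`. -/
abbrev Euc (n : ℕ) : Type := EuclideanSpace ℝ (Fin n)

/-- The open unit cube `Ω = (0,1)ⁿ`. -/
def cube (n : ℕ) : Set (Euc n) := {x | ∀ i, x i ∈ Ioo (0 : ℝ) 1}

/-- The classical partial derivative `∂ᵢ φ`. -/
def pderiv {n : ℕ} (i : Fin n) (φ : Euc n → ℝ) : Euc n → ℝ :=
  fun x => fderiv ℝ φ x (EuclideanSpace.single i 1)

/-- `F ∈ C_c^∞(A)^{n×n}` with `|F(x)|_∞ ≤ 1` for every `x`, where `|M|_∞` is the Schatten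
`∞`-norm: the largest singular value of `M`, i.e. its operator norm for the Euclidean norm. -/
structure IsTestField {n : ℕ} (A : Set (Euc n)) (F : Euc n → Matrix (Fin n) (Fin n) ℝ) :
    Prop where
  smooth : ∀ i j, ContDiff ℝ ∞ (fun x => F x i j)
  compact : ∀ i j, HasCompactSupport (fun x => F x i j)
  support : ∀ i j, tsupport (fun x => F x i j) ⊆ A
  norm_le : ∀ x, ‖Matrix.toEuclideanCLM (n := Fin n) (𝕜 := ℝ) (F x)‖ ≤ 1

/-- The pairing `∫_A ∑_{i,j} f ∂ᵢ∂ⱼ F_{i,j}`. -/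
def pairing {n : ℕ} (f : Euc n → ℝ) (A : Set (Euc n)) (F : Euc n → Matrix (Fin n) (Fin n) ℝ) :
    ℝ :=
  ∫ x in A, ∑ i, ∑ j, f x * pderiv i (pderiv j (fun y => F y i j)) x

/-- The Hessian-Schatten total variation `|D²f|(A)` (Schatten exponent `p = 1`) on an open set `A`,
a supremum over test fields. The zero field is a test field, so `ENNReal.ofReal` loses nothing. -/
def variation {n : ℕ} (f : Euc n → ℝ) (A : Set (Euc n)) : ℝ≥0∞ :=
  ⨆ (F : Euc n → Matrix (Fin n) (Fin n) ℝ) (_ : IsTestField A F), ENNReal.ofReal (pairing f A F)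

/-- `L¹(Ω)`. -/
abbrev L1 (n : ℕ) : Type := Lp ℝ 1 (volume.restrict (cube n))

/-- The subspace `𝒜 ⊆ L¹(Ω)` of affine functions. -/
def affineFunctions (n : ℕ) : Submodule ℝ (L1 n) where
  carrier := {f | ∃ a : Euc n →ᵃ[ℝ] ℝ, f =ᵐ[volume.restrict (cube n)] a}
  zero_mem' := ⟨0, by simpa using Lp.coeFn_zero ℝ 1 (volume.restrict (cube n))⟩
  add_mem' := by
    rintro f g ⟨a, ha⟩ ⟨b, hb⟩
    refine ⟨a + b, ?_⟩
    filter_upwards [Lp.coeFn_add f g, ha, hb] with x h1 h2 h3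
    change (f + g : L1 n) x = a x + b x
    rw [h1, Pi.add_apply, h2, h3]
  smul_mem' := by
    rintro c f ⟨a, ha⟩
    refine ⟨c • a, ?_⟩
    filter_upwards [Lp.coeFn_smul c f, ha] with x h1 h2
    change (c • f : L1 n) x = c • a x
    rw [h1, Pi.smul_apply, h2]

/-- The quotient space `L¹(Ω)/𝒜`. -/
abbrev L1ModAffine (n : ℕ) : Type := L1 n ⧸ affineFunctions n

/-- The canonical projection `π : L¹(Ω) → L¹(Ω)/𝒜`. -/
abbrev proj (n : ℕ) : L1 n →ₗ[ℝ] L1ModAffine n := (affineFunctions n).mkQ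

theorem isOpen_cube (n : ℕ) : IsOpen (cube n) := by
  have : cube n = ⋂ i, (fun x : Euc n => x i) ⁻¹' Ioo (0 : ℝ) 1 := by
    ext x; simp [cube]
  rw [this]
  exact isOpen_iInter_of_finite fun i => isOpen_Ioo.preimage (by fun_prop)

theorem contDiff_pderiv {n : ℕ} {φ : Euc n → ℝ} (h : ContDiff ℝ ∞ φ) (i : Fin n) :
    ContDiff ℝ ∞ (pderiv i φ) :=
  (h.fderiv_right (m := ∞) (by simp)).clm_apply contDiff_const

theorem tsupport_pderiv {n : ℕ} (φ : Euc n → ℝ) (i : Fin n) :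
    tsupport (pderiv i φ) ⊆ tsupport φ := by
  refine closure_minimal (fun x hx => ?_) (isClosed_tsupport φ)
  by_contra hx'
  apply hx
  have : φ =ᶠ[𝓝 x] fun _ => 0 := notMem_tsupport_iff_eventuallyEq.mp hx'
  simp [pderiv, this.fderiv_eq]

theorem hasCompactSupport_pderiv {n : ℕ} {φ : Euc n → ℝ} (h : HasCompactSupport φ) (i : Fin n) :
    HasCompactSupport (pderiv i φ) :=
  h.of_isClosed_subset (isClosed_tsupport _) (tsupport_pderiv φ i)

theorem integral_pderiv {n : ℕ} {φ : Euc n → ℝ} (h : ContDiff ℝ ∞ φ) (hc : HasCompactSupport φ)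
    (i : Fin n) : ∫ x, pderiv i φ x = 0 := by
  have hi := (contDiff_pderiv h i).continuous.integrable_of_hasCompactSupport (μ := volume)
    (hasCompactSupport_pderiv hc i)
  have := integral_mul_fderiv_eq_neg_fderiv_mul_of_integrable (μ := (volume : Measure (Euc n)))
    (f := fun _ => (1 : ℝ)) (g := φ) (v := EuclideanSpace.single i 1) (by simp)
    (by simp only [one_mul]; exact hi) (by simpa using h.continuous.integrable_of_hasCompactSupport hc)
    (by fun_prop) (fun x _ => h.differentiable (by simp) x)
  simpa [pderiv] using this

theorem integral_affine_mul {n : ℕ} (a : Euc n →ᵃ[ℝ] ℝ) {φ : Euc n → ℝ} (h : ContDiff ℝ ∞ φ)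
    (hc : HasCompactSupport φ) (i j : Fin n) : ∫ x, a x * pderiv i (pderiv j φ) x = 0 := by
  have hj := contDiff_pderiv h j
  have hjc := hasCompactSupport_pderiv hc j
  have hij := contDiff_pderiv hj i
  have hijc := hasCompactSupport_pderiv hjc i
  set L : Euc n →L[ℝ] ℝ := LinearMap.toContinuousLinearMap a.linear with hL
  have ha : ∀ x, a x = L x + a 0 := fun x => by
    rw [hL]; simpa using congrFun a.decomp x
  have hac : Continuous (a : Euc n → ℝ) := by
    have : (a : Euc n → ℝ) = fun x => L x + a 0 := funext ha
    rw [this]; fun_prop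
  have hd : ∀ x, HasFDerivAt (a : Euc n → ℝ) L x := fun x => by
    have : (a : Euc n → ℝ) = fun x => L x + a 0 := funext ha
    rw [this]; exact L.hasFDerivAt.add_const _
  have key := integral_mul_fderiv_eq_neg_fderiv_mul_of_integrable
    (μ := (volume : Measure (Euc n))) (f := (a : Euc n → ℝ)) (g := pderiv j φ)
    (v := EuclideanSpace.single i 1)
    (by
      simp only [(hd _).fderiv]
      exact (hj.continuous.integrable_of_hasCompactSupport hjc).const_mul _)
    ((hac.mul hij.continuous).integrable_of_hasCompactSupport (hijc.mul_left))
    ((hac.mul hj.continuous).integrable_of_hasCompactSupport (hjc.mul_left))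
    (fun x _ => (hd x).differentiableAt) (fun x _ => hj.differentiable (by simp) x)
  calc ∫ x, a x * pderiv i (pderiv j φ) x = _ := key
    _ = 0 := by
      simp only [(hd _).fderiv]
      rw [integral_const_mul, integral_pderiv h hc j]; simp

/-- Two integrable functions on `Ω` that differ by an affine function have the same pairings. -/
theorem pairing_eq {n : ℕ} {f g : L1 n} (h : f - g ∈ affineFunctions n) {A : Set (Euc n)}
    (hA : A ⊆ cube n) {F : Euc n → Matrix (Fin n) (Fin n) ℝ} (hF : IsTestField A F) :
    pairing f A F = pairing g A F := by
  obtain ⟨a, ha⟩ := h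
  have hsm := fun i j => contDiff_pderiv (contDiff_pderiv (hF.smooth i j) j) i
  have hcs := fun i j => hasCompactSupport_pderiv (hasCompactSupport_pderiv (hF.compact i j) j) i
  have hts : ∀ i j, tsupport (pderiv i (pderiv j (fun y => F y i j))) ⊆ A := fun i j =>
    ((tsupport_pderiv _ i).trans (tsupport_pderiv _ j)).trans (hF.support i j)
  have hle : volume.restrict A ≤ (volume : Measure (Euc n)).restrict (cube n) :=
    Measure.restrict_mono hA le_rfl
  have hint : ∀ (u : L1 n) i j, Integrable
      (fun x => u x * pderiv i (pderiv j (fun y => F y i j)) x) (volume.restrict A) := by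
    intro u i j
    obtain ⟨C, hC⟩ := (hsm i j).continuous.bounded_above_of_compact_support (hcs i j)
    exact ((L1.integrable_coeFn u).mono_measure hle).mul_bdd
      (hsm i j).continuous.aestronglyMeasurable (Filter.Eventually.of_forall hC)
  have hz : ∀ i j, ∫ x in A, (f x * pderiv i (pderiv j (fun y => F y i j)) x) =
      ∫ x in A, (g x * pderiv i (pderiv j (fun y => F y i j)) x) := by
    intro i j
    rw [← sub_eq_zero, ← integral_sub (hint f i j) (hint g i j)]
    calc _ = ∫ x in A, a x * pderiv i (pderiv j (fun y => F y i j)) x := by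
          refine integral_congr_ae ?_
          filter_upwards [ae_mono hle ha, ae_mono hle (Lp.coeFn_sub f g)] with x h1 h2
          rw [← h1, h2]; simp [sub_mul]
      _ = ∫ x, a x * pderiv i (pderiv j (fun y => F y i j)) x := by
          refine setIntegral_eq_integral_of_forall_compl_eq_zero fun x hx => ?_
          rw [image_eq_zero_of_notMem_tsupport (fun hx' => hx (hts i j hx')), mul_zero]
      _ = 0 := integral_affine_mul a (hF.smooth i j) (hF.compact i j) i j
  unfold pairing
  rw [integral_finsetSum _ fun i _ => integrable_finsetSum _ fun j _ => hint f i j,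
    integral_finsetSum _ fun i _ => integrable_finsetSum _ fun j _ => hint g i j]
  refine Finset.sum_congr rfl fun i _ => ?_
  rw [integral_finsetSum _ fun j _ => hint f i j, integral_finsetSum _ fun j _ => hint g i j]
  exact Finset.sum_congr rfl fun j _ => hz i j

/-- `|D²q|(A)` for a class `q ∈ L¹(Ω)/𝒜` and an open set `A ⊆ Ω`: the common value of `|D²f|(A)`
over the representatives `f` of `q`. (For an arbitrary set `A` it is evaluated on `A ∩ Ω`.) -/
def classVariation {n : ℕ} (q : L1ModAffine n) (A : Set (Euc n)) : ℝ≥0∞ :=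
  Quotient.liftOn' q (fun f : L1 n => variation f (A ∩ cube n)) (by
    intro f g hfg
    have h : f - g ∈ affineFunctions n := (Submodule.quotientRel_def _).mp hfg
    refine iSup_congr fun F => iSup_congr fun hF => ?_
    rw [pairing_eq h inter_subset_right hF])

theorem classVariation_proj {n : ℕ} (f : L1 n) {A : Set (Euc n)} (hA : A ⊆ cube n) :
    classVariation (proj n f) A = variation f A := by
  change variation f (A ∩ cube n) = variation f A
  rw [inter_eq_left.mpr hA]

/-- The support, relative to `Ω`, of the measure `|D²q|`: the points of `Ω` all of whose open
neighbourhoods `A ⊆ Ω` satisfy `|D²q|(A) > 0`. Only values on open sets matter for the support. -/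
def hessianSupport {n : ℕ} (q : L1ModAffine n) : Set (Euc n) :=
  {x ∈ cube n | ∀ A : Set (Euc n), IsOpen A → A ⊆ cube n → x ∈ A → 0 < classVariation q A}

/-- Consistency: `hessianSupport q` is the topological support in `Ω` of every Borel measure whose
values on the open subsets of `Ω` are given by `|D²q|`. -/
theorem hessianSupport_eq {n : ℕ} (q : L1ModAffine n) (μ : Measure (Euc n))
    (hμ : ∀ A : Set (Euc n), IsOpen A → A ⊆ cube n → μ A = classVariation q A) :
    hessianSupport q = μ.support ∩ cube n := by
  ext x
  simp only [hessianSupport, mem_ofPred_eq, mem_inter_iff, Measure.mem_support_iff_forall]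
  constructor
  · rintro ⟨hx, h⟩
    refine ⟨fun U hU => ?_, hx⟩
    obtain ⟨V, hVU, hV, hxV⟩ := mem_nhds_iff.mp hU
    have := h (V ∩ cube n) (hV.inter (isOpen_cube n)) inter_subset_right ⟨hxV, hx⟩
    rw [← hμ _ (hV.inter (isOpen_cube n)) inter_subset_right] at this
    exact this.trans_le (measure_mono (inter_subset_left.trans hVU))
  · rintro ⟨h, hx⟩
    refine ⟨hx, fun A hA hAc hxA => ?_⟩
    rw [← hμ A hA hAc]
    exact h A (hA.mem_nhds hxA)

/-- The unit ball `ℬ = {q ∈ L¹(Ω)/𝒜 : |D²q|(Ω) ≤ 1}`. -/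
def htvBall (n : ℕ) : Set (L1ModAffine n) := {q | classVariation q (cube n) ≤ 1}

/-- The unit sphere `𝒮 = {q ∈ L¹(Ω)/𝒜 : |D²q|(Ω) = 1}`. -/
def htvSphere (n : ℕ) : Set (L1ModAffine n) := {q | classVariation q (cube n) = 1}

/-- `P` is an `n`-dimensional convex polytope of `ℝⁿ`. -/
def IsConvexPolytope {n : ℕ} (P : Set (Euc n)) : Prop :=
  (∃ s : Finset (Euc n), P = convexHull ℝ (s : Set (Euc n))) ∧ (interior P).Nonempty

/-- `f ∈ CPWL(Ω)`: `f` is continuous on `Ω`, and `ℝⁿ` is a locally finite union of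
`n`-dimensional convex polytopes that intersect only at their boundaries, such that `f` is affine
on the intersection of each of them with `Ω`. -/
def IsCPWL {n : ℕ} (Ω : Set (Euc n)) (f : Euc n → ℝ) : Prop :=
  ContinuousOn f Ω ∧
  ∃ T : Set (Set (Euc n)),
    (∀ P ∈ T, IsConvexPolytope P) ∧
    ⋃₀ T = univ ∧
    (∀ P ∈ T, ∀ Q ∈ T, P ≠ Q → P ∩ Q ⊆ frontier P ∩ frontier Q) ∧
    (∀ P ∈ T, ∃ a : Euc n →ᵃ[ℝ] ℝ, EqOn f a (P ∩ Ω)) ∧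
    (∀ (c : Euc n) (r : ℝ), {P ∈ T | (P ∩ Metric.ball c r).Nonempty}.Finite)

/-- `π(CPWL(Ω))`: the classes of (the `L¹` functions given by) CPWL functions. -/
def cpwlClasses (n : ℕ) : Set (L1ModAffine n) :=
  proj n '' {f : L1 n | ∃ φ : Euc n → ℝ, IsCPWL (cube n) φ ∧ f =ᵐ[volume.restrict (cube n)] φ}

/-- `ℰ = π(CPWL(Ω)) ∩ ext(ℬ)`. -/
def cpwlExtremePoints (n : ℕ) : Set (L1ModAffine n) :=
  cpwlClasses n ∩ (htvBall n).extremePoints ℝ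

end HTV

end

open MeasureTheory Set Topology
open scoped ENNReal ContDiff

noncomputable section

namespace HTV

/-- The double divergence `∑ᵢⱼ ∂ᵢ∂ⱼ Fᵢⱼ` of a matrix field. -/
def ddiv {n : ℕ} (F : Euc n → Matrix (Fin n) (Fin n) ℝ) (x : Euc n) : ℝ :=
  ∑ i, ∑ j, pderiv i (pderiv j (fun y => F y i j)) x

theorem pderiv_add {n : ℕ} {φ ψ : Euc n → ℝ} (hφ : ContDiff ℝ ∞ φ) (hψ : ContDiff ℝ ∞ ψ)
    (i : Fin n) : pderiv i (fun x => φ x + ψ x) = fun x => pderiv i φ x + pderiv i ψ x := by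
  funext x
  simp only [pderiv]
  rw [fderiv_fun_add (hφ.differentiable (by simp) x) (hψ.differentiable (by simp) x)]
  rfl

theorem pderiv_const_mul {n : ℕ} {φ : Euc n → ℝ} (hφ : ContDiff ℝ ∞ φ) (c : ℝ)
    (i : Fin n) : pderiv i (fun x => c * φ x) = fun x => c * pderiv i φ x := by
  funext x
  simp only [pderiv]
  rw [fderiv_const_mul (hφ.differentiable (by simp) x)]
  rfl

theorem pderiv_eq_zero_of_notMem_tsupport {n : ℕ} {φ : Euc n → ℝ} {x : Euc n}
    (hx : x ∉ tsupport φ) (i : Fin n) : pderiv i φ x = 0 :=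
  image_eq_zero_of_notMem_tsupport fun h => hx (tsupport_pderiv φ i h)

namespace IsTestField

variable {n : ℕ} {A B : Set (Euc n)} {F G : Euc n → Matrix (Fin n) (Fin n) ℝ}

theorem contDiff_ddiv (hF : IsTestField A F) : ContDiff ℝ ∞ (ddiv F) := by
  unfold ddiv
  exact ContDiff.sum fun i _ => ContDiff.sum fun j _ =>
    contDiff_pderiv (contDiff_pderiv (hF.smooth i j) j) i

theorem ddiv_eq_zero (hF : IsTestField A F) {x : Euc n} (hx : x ∉ A) : ddiv F x = 0 := by
  refine Finset.sum_eq_zero fun i _ => Finset.sum_eq_zero fun j _ => ?_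
  exact pderiv_eq_zero_of_notMem_tsupport
    (fun h => hx (hF.support i j (tsupport_pderiv _ j h))) i

theorem hasCompactSupport_ddiv (hF : IsTestField A F) : HasCompactSupport (ddiv F) := by
  have hK : IsCompact (⋃ i, ⋃ j, tsupport (fun y => F y i j)) :=
    isCompact_iUnion fun i => isCompact_iUnion fun j => hF.compact i j
  refine HasCompactSupport.intro hK fun x hx => ?_
  simp only [mem_iUnion, not_exists] at hx
  refine Finset.sum_eq_zero fun i _ => Finset.sum_eq_zero fun j _ => ?_
  exact pderiv_eq_zero_of_notMem_tsupport (fun h => hx i j (tsupport_pderiv _ j h)) i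

theorem eq_zero (hF : IsTestField A F) {x : Euc n} (hx : x ∉ A) : F x = 0 := by
  ext i j
  exact image_eq_zero_of_notMem_tsupport (f := fun y => F y i j) fun h => hx (hF.support i j h)

theorem mono (hF : IsTestField A F) (h : A ⊆ B) : IsTestField B F :=
  ⟨hF.smooth, hF.compact, fun i j => (hF.support i j).trans h, hF.norm_le⟩

theorem neg (hF : IsTestField A F) : IsTestField A (-F) where
  smooth i j := (hF.smooth i j).neg
  compact i j := (hF.compact i j).neg
  support i j := by
    have : (fun x => (-F) x i j) = -fun x => F x i j := rfl
    rw [this, tsupport_neg]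
    exact hF.support i j
  norm_le x := by
    rw [Pi.neg_apply, map_neg, norm_neg]
    exact hF.norm_le x

theorem smul (hF : IsTestField A F) {η : Euc n → ℝ} (hη : ContDiff ℝ ∞ η)
    (h1 : ∀ x, |η x| ≤ 1) (h : ∀ x ∈ A, x ∉ B → ∀ᶠ y in 𝓝 x, η y = 0) :
    IsTestField B (fun x => η x • F x) where
  smooth i j := hη.mul (hF.smooth i j)
  compact i j := HasCompactSupport.mul_left (f := η) (hF.compact i j)
  support i j := by
    intro x hx
    have hxA : x ∈ A := hF.support i j (tsupport_mul_subset_right (f := η) hx)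
    by_contra hxB
    refine notMem_tsupport_iff_eventuallyEq.mpr ?_ hx
    filter_upwards [h x hxA hxB] with y hy
    simp [hy]
  norm_le x := by
    rw [map_smul, norm_smul, Real.norm_eq_abs]
    exact mul_le_one₀ (h1 x) (norm_nonneg _) (hF.norm_le x)

theorem add (hF : IsTestField A F) (hG : IsTestField B G) (hAB : Disjoint A B) :
    IsTestField (A ∪ B) (F + G) where
  smooth i j := (hF.smooth i j).add (hG.smooth i j)
  compact i j := (hF.compact i j).add (hG.compact i j)
  support i j := by
    refine (tsupport_add (fun x => F x i j) (fun x => G x i j)).trans ?_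
    exact union_subset_union (hF.support i j) (hG.support i j)
  norm_le x := by
    by_cases hx : x ∈ A
    · rw [Pi.add_apply, hG.eq_zero (disjoint_left.mp hAB hx), add_zero]
      exact hF.norm_le x
    · rw [Pi.add_apply, hF.eq_zero hx, zero_add]
      exact hG.norm_le x

theorem ddiv_add (hF : IsTestField A F) (hG : IsTestField B G) (x : Euc n) :
    ddiv (F + G) x = ddiv F x + ddiv G x := by
  simp only [ddiv, ← Finset.sum_add_distrib]
  refine Finset.sum_congr rfl fun i _ => Finset.sum_congr rfl fun j _ => ?_
  have : (fun y => (F + G) y i j) = fun y => F y i j + G y i j := rfl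
  rw [this, pderiv_add (hF.smooth i j) (hG.smooth i j),
    pderiv_add (contDiff_pderiv (hF.smooth i j) j) (contDiff_pderiv (hG.smooth i j) j)]

theorem ddiv_neg (hF : IsTestField A F) (x : Euc n) : ddiv (-F) x = - ddiv F x := by
  simp only [ddiv, ← Finset.sum_neg_distrib]
  refine Finset.sum_congr rfl fun i _ => Finset.sum_congr rfl fun j _ => ?_
  have : (fun y => (-F) y i j) = fun y => (-1) * F y i j := by funext y; simp
  rw [this, pderiv_const_mul (hF.smooth i j),
    pderiv_const_mul (contDiff_pderiv (hF.smooth i j) j)]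
  simp

theorem integrable (hF : IsTestField A F) {f : Euc n → ℝ} (hf : Integrable f) :
    Integrable fun x => f x * ddiv F x := by
  obtain ⟨C, hC⟩ := hF.contDiff_ddiv.continuous.bounded_above_of_compact_support
    hF.hasCompactSupport_ddiv
  exact hf.mul_bdd hF.contDiff_ddiv.continuous.aestronglyMeasurable
    (Filter.Eventually.of_forall hC)

theorem pairing_eq_integral (hF : IsTestField A F) (f : Euc n → ℝ) :
    pairing f A F = ∫ x, f x * ddiv F x := by
  simp only [pairing, ddiv, ← Finset.mul_sum]
  refine setIntegral_eq_integral_of_forall_compl_eq_zero fun x hx => ?_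
  have := hF.ddiv_eq_zero hx
  rw [ddiv] at this
  rw [this, mul_zero]

end IsTestField

theorem isTestField_zero {n : ℕ} (A : Set (Euc n)) :
    IsTestField A (0 : Euc n → Matrix (Fin n) (Fin n) ℝ) where
  smooth i j := contDiff_const
  compact i j := HasCompactSupport.zero
  support i j := by
    have : (fun x => (0 : Euc n → Matrix (Fin n) (Fin n) ℝ) x i j) = 0 := rfl
    rw [this]
    simp [tsupport]
  norm_le x := by simp

section Variation

variable {n : ℕ} {A B C : Set (Euc n)} {f g : Euc n → ℝ}

theorem ofReal_le_variation {F : Euc n → Matrix (Fin n) (Fin n) ℝ} (hF : IsTestField A F)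
    (f : Euc n → ℝ) : ENNReal.ofReal (∫ x, f x * ddiv F x) ≤ variation f A := by
  rw [← hF.pairing_eq_integral f]
  exact le_iSup₂_of_le F hF le_rfl

theorem variation_le {c : ℝ≥0∞}
    (h : ∀ F, IsTestField A F → ENNReal.ofReal (∫ x, f x * ddiv F x) ≤ c) :
    variation f A ≤ c :=
  iSup₂_le fun F hF => by
    rw [hF.pairing_eq_integral f]
    exact h F hF

theorem variation_mono (f : Euc n → ℝ) (h : A ⊆ B) : variation f A ≤ variation f B :=
  variation_le fun _ hF => ofReal_le_variation (hF.mono h) f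

theorem variation_congr (hA : MeasurableSet A) (h : ∀ᵐ x, x ∈ A → f x = g x) :
    variation f A = variation g A := by
  refine iSup_congr fun F => iSup_congr fun hF => ?_
  congr 1
  refine setIntegral_congr_ae hA ?_
  filter_upwards [h] with x hx hxA
  rw [hx hxA]

theorem variation_add_le (hf : Integrable f) (hg : Integrable g) (A : Set (Euc n)) :
    variation (f + g) A ≤ variation f A + variation g A := by
  refine variation_le fun F hF => ?_
  have : ∫ x, (f + g) x * ddiv F x = (∫ x, f x * ddiv F x) + ∫ x, g x * ddiv F x := by
    rw [← integral_add (hF.integrable hf) (hF.integrable hg)]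
    simp [add_mul]
  rw [this]
  exact ENNReal.ofReal_add_le.trans
    (add_le_add (ofReal_le_variation hF f) (ofReal_le_variation hF g))

theorem ofReal_abs_le_variation {F : Euc n → Matrix (Fin n) (Fin n) ℝ} (hF : IsTestField A F)
    (f : Euc n → ℝ) : ENNReal.ofReal |∫ x, f x * ddiv F x| ≤ variation f A := by
  rcases abs_cases (∫ x, f x * ddiv F x) with ⟨h, -⟩ | ⟨h, -⟩
  · rw [h]
    exact ofReal_le_variation hF f
  · rw [h]
    have : - ∫ x, f x * ddiv F x = ∫ x, f x * ddiv (-F) x := by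
      rw [← integral_neg]
      simp [hF.ddiv_neg]
    rw [this]
    exact ofReal_le_variation hF.neg f

theorem variation_smul_le (c : ℝ) (f : Euc n → ℝ) (A : Set (Euc n)) :
    variation (c • f) A ≤ ENNReal.ofReal |c| * variation f A := by
  refine variation_le fun F hF => ?_
  have : ∫ x, (c • f) x * ddiv F x = c * ∫ x, f x * ddiv F x := by
    rw [← integral_const_mul]
    simp [mul_assoc]
  rw [this]
  refine (ENNReal.ofReal_le_ofReal (le_abs_self _)).trans ?_
  rw [abs_mul, ENNReal.ofReal_mul (abs_nonneg c)]
  gcongr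
  exact ofReal_abs_le_variation hF f

theorem variation_empty (f : Euc n → ℝ) : variation f ∅ = 0 := by
  refine le_antisymm (variation_le fun F hF => ?_) zero_le
  simp [hF.ddiv_eq_zero (notMem_empty _)]

theorem exists_smooth_cutoff {K L : Set (Euc n)} (hK : IsClosed K) (hL : IsClosed L)
    (h : Disjoint K L) : ∃ η : Euc n → ℝ, ContDiff ℝ ∞ η ∧ (∀ x ∈ K, ∀ᶠ y in 𝓝 x, η y = 0) ∧
      (∀ x ∈ L, ∀ᶠ y in 𝓝 x, η y = 1) ∧ ∀ x, η x ∈ Icc (0 : ℝ) 1 := by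
  obtain ⟨η, h0, h1, h2⟩ :=
    exists_contMDiffMap_zero_one_nhds_of_isClosed (n := (⊤ : ℕ∞)) (modelWithCornersSelf ℝ (Euc n)) hK hL h
  exact ⟨η, η.contMDiff.contDiff, eventually_nhdsSet_iff_forall.mp h0,
    eventually_nhdsSet_iff_forall.mp h1, h2⟩

theorem variation_union_le (hf : Integrable f) (hA : IsOpen A) (hB : IsOpen B) :
    variation f (A ∪ B) ≤ variation f A + variation f B := by
  refine variation_le fun F hF => ?_
  set K : Set (Euc n) := ⋃ i, ⋃ j, tsupport (fun y => F y i j) with hKdef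
  have hK : IsCompact K := isCompact_iUnion fun i => isCompact_iUnion fun j => hF.compact i j
  have hKsub : K ⊆ A ∪ B := iUnion_subset fun i => iUnion_subset fun j => hF.support i j
  have hFK : IsTestField K F := ⟨hF.smooth, hF.compact, fun i j =>
    (subset_iUnion (fun j => tsupport (fun y => F y i j)) j).trans
      (subset_iUnion (fun i => ⋃ j, tsupport (fun y => F y i j)) i), hF.norm_le⟩
  have hdis : Disjoint (K \ A) (K \ B) := by
    rw [disjoint_left]
    rintro x ⟨hx, hxA⟩ ⟨-, hxB⟩
    exact (hKsub hx).elim hxA hxB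
  obtain ⟨η, hη, h0, h1, h01⟩ := exists_smooth_cutoff (hK.isClosed.sdiff hA)
    (hK.isClosed.sdiff hB) hdis
  have hF1 : IsTestField A (fun x => η x • F x) :=
    hFK.smul hη (fun x => abs_le.mpr ⟨by linarith [(h01 x).1], (h01 x).2⟩)
      (fun x hx hxA => h0 x ⟨hx, hxA⟩)
  have hF2 : IsTestField B (fun x => (1 - η x) • F x) :=
    hFK.smul (contDiff_const.sub hη)
      (fun x => abs_le.mpr ⟨by linarith [(h01 x).2], by linarith [(h01 x).1]⟩)
      (fun x hx hxA => by
        filter_upwards [h1 x ⟨hx, hxA⟩] with y hy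
        rw [hy, sub_self])
  have hsum : F = (fun x => η x • F x) + fun x => (1 - η x) • F x := by
    funext x
    simp [← add_smul]
  have : ∫ x, f x * ddiv F x = (∫ x, f x * ddiv (fun x => η x • F x) x) +
      ∫ x, f x * ddiv (fun x => (1 - η x) • F x) x := by
    rw [← integral_add (hF1.integrable hf) (hF2.integrable hf)]
    refine integral_congr_ae (Filter.Eventually.of_forall fun x => ?_)
    have h := hF1.ddiv_add hF2 x
    rw [← hsum] at h
    simp only [h, mul_add]
  rw [this]
  exact ENNReal.ofReal_add_le.trans
    (add_le_add (ofReal_le_variation hF1 f) (ofReal_le_variation hF2 f))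

theorem variation_biUnion_le {ι : Type*} (hf : Integrable f) (s : Finset ι)
    {U : ι → Set (Euc n)} (hU : ∀ i, IsOpen (U i)) :
    variation f (⋃ i ∈ s, U i) ≤ ∑ i ∈ s, variation f (U i) := by
  classical
  induction s using Finset.induction_on with
  | empty => simp [variation_empty]
  | insert a s ha ih =>
    rw [Finset.set_biUnion_insert, Finset.sum_insert ha]
    refine (variation_union_le hf (hU a) (isOpen_biUnion fun i _ => hU i)).trans ?_
    exact add_le_add le_rfl ih

theorem variation_add_variation_le (hf : Integrable f) (hAB : Disjoint A B) :
    variation f A + variation f B ≤ variation f (A ∪ B) := by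
  unfold variation
  refine ENNReal.biSup_add_biSup_le' ⟨0, isTestField_zero A⟩ ⟨0, isTestField_zero B⟩
    fun F hF G hG => ?_
  rw [hF.pairing_eq_integral f, hG.pairing_eq_integral f]
  change _ ≤ variation f (A ∪ B)
  rcases le_total (∫ x, f x * ddiv F x) 0 with h | h
  · rw [ENNReal.ofReal_of_nonpos h, zero_add]
    exact ofReal_le_variation (hG.mono subset_union_right) f
  rcases le_total (∫ x, f x * ddiv G x) 0 with h' | h'
  · rw [ENNReal.ofReal_of_nonpos h', add_zero]
    exact ofReal_le_variation (hF.mono subset_union_left) f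
  rw [← ENNReal.ofReal_add h h', ← integral_add (hF.integrable hf) (hG.integrable hf)]
  have := ofReal_le_variation (hF.add hG hAB) f
  simpa only [hF.ddiv_add hG, mul_add] using this

theorem sum_variation_le {ι : Type*} (hf : Integrable f) (s : Finset ι)
    {U : ι → Set (Euc n)} (hd : Pairwise fun i j => Disjoint (U i) (U j)) :
    ∑ i ∈ s, variation f (U i) ≤ variation f (⋃ i ∈ s, U i) := by
  classical
  induction s using Finset.induction_on with
  | empty => simp
  | insert a s ha ih =>
    rw [Finset.set_biUnion_insert, Finset.sum_insert ha]
    refine le_trans ?_ (variation_add_variation_le hf ?_)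
    · gcongr
    · rw [disjoint_iUnion₂_right]
      exact fun i hi => hd fun h => ha (h ▸ hi)

theorem variation_eq_zero_of_locally (hf : Integrable f)
    (h : ∀ x ∈ A, ∃ U, IsOpen U ∧ x ∈ U ∧ variation f U = 0) : variation f A = 0 := by
  refine le_antisymm (variation_le fun F hF => ?_) zero_le
  choose! U hU hxU hz using h
  set K : Set (Euc n) := ⋃ i, ⋃ j, tsupport (fun y => F y i j) with hKdef
  have hK : IsCompact K := isCompact_iUnion fun i => isCompact_iUnion fun j => hF.compact i j
  have hKsub : K ⊆ A := iUnion_subset fun i => iUnion_subset fun j => hF.support i j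
  obtain ⟨t, ht⟩ := hK.elim_finite_subcover (fun x : A => U x) (fun x => hU x x.2)
    (fun x hx => mem_iUnion.mpr ⟨⟨x, hKsub hx⟩, hxU x (hKsub hx)⟩)
  have hF' : IsTestField (⋃ x ∈ t, U x) F := ⟨hF.smooth, hF.compact, fun i j =>
    ((subset_iUnion (fun j => tsupport (fun y => F y i j)) j).trans
      (subset_iUnion (fun i => ⋃ j, tsupport (fun y => F y i j)) i)).trans ht, hF.norm_le⟩
  refine (ofReal_le_variation hF' f).trans ?_
  refine (variation_biUnion_le hf t (U := fun x : A => U x) fun x => hU x x.2).trans ?_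
  exact (Finset.sum_eq_zero fun (x : A) _ => hz x.1 x.2).le

theorem variation_affine (a : Euc n →ᵃ[ℝ] ℝ) (A : Set (Euc n)) : variation a A = 0 := by
  refine le_antisymm (variation_le fun F hF => ?_) zero_le
  have hac : Continuous (a : Euc n → ℝ) := a.continuous_of_finiteDimensional
  have hint : ∀ i j, Integrable fun x => a x * pderiv i (pderiv j (fun y => F y i j)) x :=
    fun i j => (hac.mul (contDiff_pderiv (contDiff_pderiv (hF.smooth i j) j)
      i).continuous).integrable_of_hasCompactSupport
      ((hasCompactSupport_pderiv (hasCompactSupport_pderiv (hF.compact i j) j) i).mul_left)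
  simp only [ddiv, Finset.mul_sum]
  rw [integral_finsetSum _ fun i _ => integrable_finsetSum _ fun j _ => hint i j]
  rw [Finset.sum_eq_zero fun i _ => ?_]
  · simp
  rw [integral_finsetSum _ fun j _ => hint i j]
  exact Finset.sum_eq_zero fun j _ => integral_affine_mul a (hF.smooth i j) (hF.compact i j) i j

theorem variation_eq_zero_of_ae_eq_affine (hA : MeasurableSet A) (a : Euc n →ᵃ[ℝ] ℝ)
    (h : ∀ᵐ x, x ∈ A → f x = a x) : variation f A = 0 := by
  rw [variation_congr hA h, variation_affine]

end Variation

theorem norm_toEuclideanCLM_single_le {n : ℕ} (i j : Fin n) (c : ℝ) :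
    ‖Matrix.toEuclideanCLM (n := Fin n) (𝕜 := ℝ) (Matrix.single i j c)‖ ≤ |c| := by
  refine ContinuousLinearMap.opNorm_le_bound _ (abs_nonneg c) fun x => ?_
  have : Matrix.toEuclideanCLM (n := Fin n) (𝕜 := ℝ) (Matrix.single i j c) x =
      EuclideanSpace.single i (c * x j) := by
    ext k
    simp [Matrix.single_mulVec, EuclideanSpace.single, Function.update_apply]
  rw [this, PiLp.norm_single, norm_mul, Real.norm_eq_abs]
  gcongr
  exact PiLp.norm_apply_le x j

section HessianBound

variable {n : ℕ} {A : Set (Euc n)} {f φ : Euc n → ℝ}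

theorem isTestField_single (hφ : ContDiff ℝ ∞ φ) (hc : HasCompactSupport φ)
    (hs : tsupport φ ⊆ A) (h1 : ∀ x, |φ x| ≤ 1) (i j : Fin n) :
    IsTestField A (fun x => Matrix.single i j (φ x)) := by
  have key : ∀ k l, (fun x => Matrix.single i j (φ x) k l) = if i = k ∧ j = l then φ else 0 := by
    intro k l
    funext x
    rw [Matrix.single_apply]
    split_ifs <;> rfl
  refine ⟨fun k l => ?_, fun k l => ?_, fun k l => ?_, fun x =>
    (norm_toEuclideanCLM_single_le i j _).trans (h1 x)⟩
  all_goals rw [key]; split_ifs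
  · exact hφ
  · exact contDiff_const
  · exact hc
  · exact HasCompactSupport.zero
  · exact hs
  · simp [tsupport]

theorem pderiv_zero {n : ℕ} (i : Fin n) : pderiv i (0 : Euc n → ℝ) = 0 := by
  funext x
  simp [pderiv]

theorem ddiv_single (φ : Euc n → ℝ) (i j : Fin n) (x : Euc n) :
    ddiv (fun x => Matrix.single i j (φ x)) x = pderiv i (pderiv j φ) x := by
  have key : ∀ k l, (fun x => Matrix.single i j (φ x) k l) = if i = k ∧ j = l then φ else 0 := by
    intro k l
    funext x
    rw [Matrix.single_apply]
    split_ifs <;> rfl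
  simp only [ddiv, key]
  rw [Finset.sum_eq_single i, Finset.sum_eq_single j]
  · simp
  · intro l _ hl
    simp [hl.symm, pderiv_zero]
  · simp
  · intro k _ hk
    refine Finset.sum_eq_zero fun l _ => ?_
    simp [hk.symm, pderiv_zero]
  · simp

theorem abs_integral_mul_pderiv_pderiv_le (hφ : ContDiff ℝ ∞ φ) (hc : HasCompactSupport φ)
    (hs : tsupport φ ⊆ A) {C : ℝ} (hC : 0 < C) (h1 : ∀ x, |φ x| ≤ C) (i j : Fin n)
    (hfin : variation f A ≠ ⊤) :
    |∫ x, f x * pderiv i (pderiv j φ) x| ≤ C * (variation f A).toReal := by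
  set ψ : Euc n → ℝ := fun x => C⁻¹ * φ x with hψdef
  have hψ : ContDiff ℝ ∞ ψ := contDiff_const.mul hφ
  have hψs : tsupport ψ ⊆ tsupport φ := tsupport_mul_subset_right (f := fun _ => C⁻¹)
  have hψc : HasCompactSupport ψ := HasCompactSupport.mul_left (f := fun _ => C⁻¹) hc
  have hψ1 : ∀ x, |ψ x| ≤ 1 := fun x => by
    rw [hψdef, abs_mul, abs_of_pos (inv_pos.mpr hC), inv_mul_le_iff₀ hC, mul_one]
    exact h1 x
  have h := ofReal_abs_le_variation (isTestField_single hψ hψc (hψs.trans hs) hψ1 i j) f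
  rw [← ENNReal.ofReal_toReal hfin, ENNReal.ofReal_le_ofReal_iff ENNReal.toReal_nonneg] at h
  have e : ∫ x, f x * pderiv i (pderiv j φ) x =
      C * ∫ x, f x * ddiv (fun x => Matrix.single i j (ψ x)) x := by
    rw [← integral_const_mul]
    refine integral_congr_ae (Filter.Eventually.of_forall fun x => ?_)
    simp only [ddiv_single]
    rw [hψdef, pderiv_const_mul hφ, pderiv_const_mul (contDiff_pderiv hφ j)]
    field_simp
  rw [e, abs_mul, abs_of_pos hC]
  gcongr

end HessianBound

section Conv

variable {n : ℕ} {f ψ : Euc n → ℝ}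

/-- The convolution of `f` with a test function `ψ`. -/
def conv (f ψ : Euc n → ℝ) (z : Euc n) : ℝ := ∫ y, f y * ψ (z - y)

theorem conv_eq_convolution (f ψ : Euc n → ℝ) :
    conv f ψ = convolution f ψ (ContinuousLinearMap.mul ℝ ℝ) volume := by
  funext z
  simp [conv, convolution]

theorem contDiff_conv (hf : Integrable f) (hψ : ContDiff ℝ ∞ ψ) (hc : HasCompactSupport ψ) :
    ContDiff ℝ ∞ (conv f ψ) := by
  rw [conv_eq_convolution]
  exact hc.contDiff_convolution_right _ hf.locallyIntegrable hψ

theorem pderiv_conv (hf : Integrable f) (hψ : ContDiff ℝ ∞ ψ) (hc : HasCompactSupport ψ)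
    (i : Fin n) : pderiv i (conv f ψ) = conv f (pderiv i ψ) := by
  funext z
  rw [conv_eq_convolution, pderiv]
  rw [(hc.hasFDerivAt_convolution_right (ContinuousLinearMap.mul ℝ ℝ) hf.locallyIntegrable
    (hψ.of_le (by simp)) z).fderiv]
  rw [convolution, ContinuousLinearMap.integral_apply]
  · simp [conv, pderiv, ContinuousLinearMap.precompR_apply]
  · exact (hc.fderiv ℝ).convolutionExists_right _ hf.locallyIntegrable
      (hψ.continuous_fderiv (by simp)) z

theorem pderiv_comp_const_sub (hψ : ContDiff ℝ ∞ ψ) (z : Euc n) (i : Fin n) :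
    pderiv i (fun y => ψ (z - y)) = fun y => (-1) * pderiv i ψ (z - y) := by
  funext y
  have h : HasFDerivAt (fun y => ψ (z - y))
      ((fderiv ℝ ψ (z - y)).comp (-ContinuousLinearMap.id ℝ (Euc n))) y :=
    ((hψ.differentiable (by simp)) (z - y)).hasFDerivAt.comp y
      ((hasFDerivAt_id y).const_sub z)
  simp [pderiv, h.fderiv]

theorem contDiff_comp_const_sub (hψ : ContDiff ℝ ∞ ψ) (z : Euc n) :
    ContDiff ℝ ∞ (fun y => ψ (z - y)) := hψ.comp (contDiff_const.sub contDiff_id)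

theorem tsupport_comp_const_sub (ψ : Euc n → ℝ) (z : Euc n) :
    tsupport (fun y => ψ (z - y)) = {y | z - y ∈ tsupport ψ} :=
  tsupport_comp_eq_preimage ψ (Homeomorph.subLeft z)

theorem hasCompactSupport_comp_const_sub (hc : HasCompactSupport ψ) (z : Euc n) :
    HasCompactSupport (fun y => ψ (z - y)) :=
  hc.comp_homeomorph (Homeomorph.subLeft z)

theorem pderiv_pderiv_conv (hf : Integrable f) (hψ : ContDiff ℝ ∞ ψ) (hc : HasCompactSupport ψ)
    (i j : Fin n) (z : Euc n) : pderiv i (pderiv j (conv f ψ)) z =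
      ∫ y, f y * pderiv i (pderiv j (fun y => ψ (z - y))) y := by
  rw [pderiv_conv hf hψ hc, pderiv_conv hf (contDiff_pderiv hψ j) (hasCompactSupport_pderiv hc j),
    conv]
  refine integral_congr_ae (Filter.Eventually.of_forall fun y => ?_)
  have hs := contDiff_comp_const_sub (contDiff_pderiv hψ j) z
  simp only
  rw [pderiv_comp_const_sub hψ, pderiv_const_mul hs, pderiv_comp_const_sub (contDiff_pderiv hψ j)]
  ring

theorem abs_pderiv_pderiv_conv_le {A : Set (Euc n)} (hf : Integrable f) (hψ : ContDiff ℝ ∞ ψ)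
    (hc : HasCompactSupport ψ) {C : ℝ} (hC : 0 < C) (h1 : ∀ x, |ψ x| ≤ C) (i j : Fin n)
    (hfin : variation f A ≠ ⊤) {z : Euc n} (hz : ∀ y, z - y ∈ tsupport ψ → y ∈ A) :
    |pderiv i (pderiv j (conv f ψ)) z| ≤ C * (variation f A).toReal := by
  rw [pderiv_pderiv_conv hf hψ hc]
  refine abs_integral_mul_pderiv_pderiv_le (contDiff_comp_const_sub hψ z)
    (hasCompactSupport_comp_const_sub hc z) ?_ hC (fun x => h1 _) i j hfin
  rw [tsupport_comp_const_sub]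
  exact fun y hy => hz y hy

end Conv

section Affine

variable {n : ℕ}

theorem eq_sum_single (x : Euc n) : x = ∑ i, x i • EuclideanSpace.single i (1 : ℝ) := by
  have := (EuclideanSpace.basisFun (Fin n) ℝ).sum_repr x
  simpa using this.symm

theorem eq_of_pderiv_eq_zero {u : Euc n → ℝ} (hu : Differentiable ℝ u) {S : Set (Euc n)}
    (hS : Convex ℝ S) (h : ∀ z ∈ S, ∀ i, pderiv i u z = 0) {x y : Euc n} (hx : x ∈ S)
    (hy : y ∈ S) : u x = u y := by
  have h0 : ∀ z ∈ S, fderiv ℝ u z = 0 := fun z hz => by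
    ext v
    rw [eq_sum_single v, map_sum]
    simp only [map_smul]
    exact Finset.sum_eq_zero fun i _ => by
      have := h z hz i
      rw [pderiv] at this
      simp [this]
  have := hS.norm_image_sub_le_of_norm_hasFDerivWithin_le (f := u) (f' := fun _ => 0) (C := 0)
    (fun z hz => by
      have := (hu z).hasFDerivAt.hasFDerivWithinAt (s := S)
      rwa [h0 z hz] at this) (by simp) hy hx
  simpa [sub_eq_zero] using this

theorem exists_affine_of_pderiv_pderiv_eq_zero {w : Euc n → ℝ} (hw : ContDiff ℝ ∞ w)
    {S : Set (Euc n)} (hS : Convex ℝ S) (h : ∀ z ∈ S, ∀ i j, pderiv i (pderiv j w) z = 0) :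
    ∃ a : Euc n →ᵃ[ℝ] ℝ, EqOn w a S := by
  rcases S.eq_empty_or_nonempty with rfl | ⟨x₀, hx₀⟩
  · exact ⟨0, eqOn_empty _ _⟩
  set L : Euc n →L[ℝ] ℝ := fderiv ℝ w x₀ with hL
  have hLi : ∀ i z, pderiv i L z = pderiv i w x₀ := fun i z => by
    simp [pderiv, hL]
  have hp : ∀ z ∈ S, ∀ i, pderiv i w z = pderiv i w x₀ := fun z hz i =>
    eq_of_pderiv_eq_zero ((contDiff_pderiv hw i).differentiable (by simp)) hS
      (fun z hz j => h z hz j i) hz hx₀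
  have hd : Differentiable ℝ (fun z => w z - L z) :=
    (hw.differentiable (by simp)).sub L.differentiable
  have hc : ∀ z ∈ S, w z - L z = w x₀ - L x₀ := fun z hz =>
    eq_of_pderiv_eq_zero hd hS (fun y hy i => by
      have e := hp y hy i
      have e' := hLi i y
      simp only [pderiv] at e e' ⊢
      rw [fderiv_fun_sub (hw.differentiable (by simp) y) (L.differentiable y)]
      rw [sub_apply, e, e', sub_self]) hz hx₀
  refine ⟨(L : Euc n →ₗ[ℝ] ℝ).toAffineMap + AffineMap.const ℝ _ (w x₀ - L x₀), fun z hz => ?_⟩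
  have := hc z hz
  simp only [AffineMap.coe_add, Pi.add_apply, LinearMap.coe_toAffineMap, AffineMap.const_apply,
    ContinuousLinearMap.coe_coe]
  linarith

theorem exists_affine_of_tendsto {E : Type*} [AddCommGroup E] [Module ℝ E] {a : ℕ → E →ᵃ[ℝ] ℝ}
    {S : Set E} (hS : affineSpan ℝ S = ⊤) {u : E → ℝ}
    (h : ∀ x ∈ S, Filter.Tendsto (fun k => a k x) Filter.atTop (𝓝 (u x))) :
    ∃ b : E →ᵃ[ℝ] ℝ, EqOn u b S := by
  let D : AffineSubspace ℝ E :=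
    { carrier := {x | ∃ l, Filter.Tendsto (fun k => a k x) Filter.atTop (𝓝 l)}
      smul_vsub_vadd_mem' := by
        rintro c p q r ⟨l, hl⟩ ⟨l', hl'⟩ ⟨l'', hl''⟩
        refine ⟨c * (l - l') + l'', ?_⟩
        have : ∀ k, a k (c • (p -ᵥ q) +ᵥ r) = c * (a k p - a k q) + a k r := fun k => by
          rw [AffineMap.map_vadd, map_smul, AffineMap.linearMap_vsub]
          simp
        simp only [this]
        exact ((hl.sub hl').const_mul c).add hl'' }
  have hD : ∀ x, ∃ l, Filter.Tendsto (fun k => a k x) Filter.atTop (𝓝 l) := fun x => by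
    have : affineSpan ℝ S ≤ D := affineSpan_le.mpr fun x hx => ⟨u x, h x hx⟩
    rw [hS] at this
    exact this (AffineSubspace.mem_top ℝ E x)
  choose l hl using hD
  refine ⟨AffineMap.mk' l (IsLinearMap.mk' (fun v => l v - l 0) ⟨fun v w => ?_, fun c v => ?_⟩) 0
    fun p => ?_, fun x hx => tendsto_nhds_unique (h x hx) (hl x)⟩
  · have h1 : ∀ k, a k (v + w) = a k v + a k w - a k 0 := fun k => by
      have e1 := (a k).map_vadd w v
      have e2 := (a k).map_vadd 0 v
      simp only [vadd_eq_add, add_zero] at e1 e2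
      rw [e1, e2]; ring
    have := tendsto_nhds_unique (hl (v + w))
      (by simp only [h1]; exact ((hl v).add (hl w)).sub (hl 0))
    rw [this]; ring
  · have h1 : ∀ k, a k (c • v) = c * (a k v - a k 0) + a k 0 := fun k => by
      have e1 := (a k).map_vadd 0 (c • v)
      have e2 := (a k).map_vadd 0 v
      simp only [vadd_eq_add, add_zero, map_smul, smul_eq_mul] at e1 e2
      rw [e1, e2]; ring
    have := tendsto_nhds_unique (hl (c • v))
      (by simp only [h1]; exact (((hl v).sub (hl 0)).const_mul c).add (hl 0))
    rw [this]; simp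
  · simp

theorem affineSpan_eq_top_of_ae {A : Set (Euc n)} (hA : IsOpen A) (hne : A.Nonempty)
    {p : Euc n → Prop} (hp : ∀ᵐ x, p x) : affineSpan ℝ {x ∈ A | p x} = ⊤ := by
  have hd : Dense {x | p x} := Measure.dense_of_ae hp
  have h1 : A ⊆ closure {x ∈ A | p x} := hd.open_subset_closure_inter hA
  have h2 : closure {x ∈ A | p x} ⊆ (affineSpan ℝ {x ∈ A | p x} : Set (Euc n)) :=
    closure_minimal (subset_affineSpan ℝ _) (AffineSubspace.closed_of_finiteDimensional _)
  rw [eq_top_iff, ← hA.affineSpan_eq_top hne]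
  exact affineSpan_le.mpr (h1.trans h2)

/-- A function without Hessian variation on a convex open set is affine there. -/
theorem exists_affine_of_variation_eq_zero {f : Euc n → ℝ} (hf : Integrable f) {A : Set (Euc n)}
    (hA : IsOpen A) (hconv : Convex ℝ A) (h0 : variation f A = 0) :
    ∃ a : Euc n →ᵃ[ℝ] ℝ, ∀ᵐ x, x ∈ A → f x = a x := by
  rcases A.eq_empty_or_nonempty with rfl | hne
  · exact ⟨0, by simp⟩
  let φ : ℕ → ContDiffBump (0 : Euc n) := fun k =>
    ⟨1 / (2 * (k + 1)), 1 / (k + 1), by positivity, by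
      rw [div_lt_div_iff₀ (by positivity) (by positivity)]
      have : (0 : ℝ) ≤ k := k.cast_nonneg
      linarith⟩
  have hφ : Filter.Tendsto (fun k => (φ k).rOut) Filter.atTop (𝓝 0) :=
    tendsto_one_div_add_atTop_nhds_zero_nat
  have hlim : ∀ᵐ x, Filter.Tendsto (fun k => conv f ((φ k).normed volume) x) Filter.atTop
      (𝓝 (f x)) := by
    have := ContDiffBump.ae_convolution_tendsto_right_of_locallyIntegrable (K := 2) hφ
      (Filter.Eventually.of_forall fun k => by
        change (1 : ℝ) / (k + 1) ≤ 2 * (1 / (2 * (k + 1)))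
        apply le_of_eq
        field_simp) hf.locallyIntegrable (μ := volume)
    filter_upwards [this] with x hx
    refine hx.congr fun k => ?_
    rw [convolution_eq_swap, conv]
    simp [mul_comm]
  let S : ℕ → Set (Euc n) := fun k => {z | Metric.closedBall z (φ k).rOut ⊆ A}
  have hSc : ∀ k, Convex ℝ (S k) := by
    intro k x hx y hy s t hs ht hst z hz
    have e : z = s • (x + (z - (s • x + t • y))) + t • (y + (z - (s • x + t • y))) := by
      have : s • (z - (s • x + t • y)) + t • (z - (s • x + t • y)) = z - (s • x + t • y) := by
        rw [← add_smul, hst, one_smul]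
      rw [smul_add, smul_add, add_add_add_comm, this]
      abel
    have hn : ‖z - (s • x + t • y)‖ ≤ (φ k).rOut := by
      rwa [Metric.mem_closedBall, dist_eq_norm] at hz
    rw [e]
    exact hconv (hx (by simpa [dist_eq_norm] using hn)) (hy (by simpa [dist_eq_norm] using hn))
      hs ht hst
  have haff : ∀ k, ∃ a : Euc n →ᵃ[ℝ] ℝ, EqOn (conv f ((φ k).normed volume)) a (S k) := by
    intro k
    have hcs : HasCompactSupport ((φ k).normed volume) := (φ k).hasCompactSupport_normed
    have hcd : ContDiff ℝ ∞ ((φ k).normed volume) := (φ k).contDiff_normed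
    refine exists_affine_of_pderiv_pderiv_eq_zero (contDiff_conv hf hcd hcs) (hSc k)
      fun z hz i j => ?_
    obtain ⟨C, hC⟩ := hcd.continuous.bounded_above_of_compact_support hcs
    have := abs_pderiv_pderiv_conv_le (A := A) hf hcd hcs (C := |C| + 1) (by positivity)
      (fun x => (hC x).trans ((le_abs_self C).trans (by linarith))) i j (by simp [h0]) (z := z)
      (fun y hy => by
        apply hz
        rw [(φ k).tsupport_normed_eq, Metric.mem_closedBall, dist_zero_right] at hy
        rwa [Metric.mem_closedBall, dist_comm, dist_eq_norm])
    rw [h0] at this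
    simpa using this
  choose a ha using haff
  obtain ⟨b, hb⟩ := exists_affine_of_tendsto (a := a) (affineSpan_eq_top_of_ae hA hne hlim)
    (u := f) (by
      rintro x ⟨hxA, hx⟩
      refine hx.congr' ?_
      obtain ⟨ε, hε, hball⟩ := Metric.isOpen_iff.mp hA x hxA
      filter_upwards [hφ.eventually_lt_const hε] with k hk
      exact ha k ((Metric.closedBall_subset_ball hk).trans hball))
  refine ⟨b, ?_⟩
  filter_upwards [hlim] with x hx hxA using hb ⟨hxA, hx⟩

end Affine

section NoJump

variable {n : ℕ}

theorem ae_affine_ne_zero {ℓ : Euc n →ᵃ[ℝ] ℝ} (h : ℓ.linear ≠ 0) : ∀ᵐ x, ℓ x ≠ 0 := by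
  let s : AffineSubspace ℝ (Euc n) :=
    { carrier := {x | ℓ x = 0}
      smul_vsub_vadd_mem' := by
        intro c p q r hp hq hr
        simp only [mem_ofPred_eq] at hp hq hr ⊢
        rw [AffineMap.map_vadd, map_smul, AffineMap.linearMap_vsub, hp, hq, hr]
        simp }
  have hs : s ≠ ⊤ := by
    intro hs
    apply h
    have hz : ∀ x, ℓ x = 0 := fun x => by
      have : x ∈ s := hs ▸ AffineSubspace.mem_top ℝ _ x
      exact this
    ext v
    have := ℓ.map_vadd 0 v
    simp only [hz] at this
    simpa using this.symm
  have := Measure.addHaar_affineSubspace (volume : Measure (Euc n)) s hs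
  rw [ae_iff]
  simp only [not_not]
  exact this

theorem integral_add_sub_two_mul {n : ℕ} {p q r : Euc n → ℝ} (hp : Integrable p) (hq : Integrable q)
    (hr : Integrable r) :
    ∫ x, (p x + q x - 2 * r x) = (∫ x, p x) + (∫ x, q x) - 2 * ∫ x, r x := by
  have := integral_sub (hp.add hq) (hr.const_mul 2)
  simp only [Pi.add_apply] at this
  rw [this, integral_add hp hq, integral_const_mul]

theorem hasDerivAt_comp_smul_single {w : Euc n → ℝ} (hw : Differentiable ℝ w) (i : Fin n) (c s : ℝ) :
    HasDerivAt (fun s : ℝ => w (s • c • EuclideanSpace.single i (1 : ℝ)))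
      (c * pderiv i w (s • c • EuclideanSpace.single i (1 : ℝ))) s := by
  have h1 : HasDerivAt (fun s : ℝ => s • c • EuclideanSpace.single i (1 : ℝ))
      ((1 : ℝ) • c • EuclideanSpace.single i (1 : ℝ)) s :=
    (hasDerivAt_id s).smul_const _
  have := (hw (s • c • EuclideanSpace.single i (1 : ℝ))).hasFDerivAt.comp_hasDerivAt s h1
  simpa [pderiv, Function.comp_def] using this

theorem abs_second_difference_le {u u' u'' : ℝ → ℝ} {M t : ℝ} (ht : 0 ≤ t)
    (h1 : ∀ s, HasDerivAt u (u' s) s) (h2 : ∀ s, HasDerivAt u' (u'' s) s)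
    (hM : ∀ s ∈ Icc (-t) t, |u'' s| ≤ M) : |u t + u (-t) - 2 * u 0| ≤ 2 * t ^ 2 * M := by
  have hM0 : 0 ≤ M := (abs_nonneg _).trans (hM 0 ⟨by linarith, ht⟩)
  have hq : ∀ s ∈ Icc 0 t, ‖u' s - u' (-s)‖ ≤ M * (2 * t) := by
    intro s hs
    have := (convex_Icc (-t) t).norm_image_sub_le_of_norm_hasDerivWithin_le
      (fun x _ => (h2 x).hasDerivWithinAt) hM (x := -s) (y := s)
      ⟨by linarith [hs.2], by linarith [hs.1]⟩ ⟨by linarith [hs.1], hs.2⟩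
    refine this.trans ?_
    gcongr
    rw [Real.norm_eq_abs, abs_of_nonneg (by linarith [hs.1])]
    linarith [hs.2]
  have := (convex_Icc 0 t).norm_image_sub_le_of_norm_hasDerivWithin_le
    (f := fun s => u s + u (-s)) (f' := fun s => u' s - u' (-s))
    (fun x _ => by
      have h := (h1 (-x)).comp x (hasDerivAt_neg x)
      have h' := (h1 x).add h
      simp only [mul_neg, mul_one] at h'
      exact h'.hasDerivWithinAt) hq (x := 0) (y := t) ⟨le_rfl, ht⟩ ⟨ht, le_rfl⟩
  simp only [neg_zero, sub_zero, Real.norm_eq_abs, abs_of_nonneg ht] at this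
  calc |u t + u (-t) - 2 * u 0| = |u t + u (-t) - (u 0 + u 0)| := by ring_nf
    _ ≤ M * (2 * t) * t := this
    _ = _ := by ring

theorem abs_integral_mul_second_difference_le {f ψ : Euc n → ℝ} {U : Set (Euc n)}
    (hf : Integrable f) (hfin : variation f U ≠ ⊤) (hψ : ContDiff ℝ ∞ ψ)
    (hc : HasCompactSupport ψ) (h1 : ∀ x, |ψ x| ≤ 1) (i : Fin n) (c : ℝ) {t : ℝ} (ht : 0 ≤ t)
    (hs : ∀ s ∈ Icc (-t) t, ∀ y,
      y - s • c • EuclideanSpace.single i (1 : ℝ) ∈ tsupport ψ → y ∈ U) :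
    |∫ y, f y * (ψ (y - t • c • EuclideanSpace.single i (1 : ℝ)) +
      ψ (y + t • c • EuclideanSpace.single i (1 : ℝ)) - 2 * ψ y)| ≤
      2 * t ^ 2 * (c ^ 2 * (variation f U).toReal) := by
  set v : Euc n := c • EuclideanSpace.single i (1 : ℝ) with hv
  set ψ' : Euc n → ℝ := fun y => ψ (0 - y) with hψ'
  have hψ's : ContDiff ℝ ∞ ψ' := contDiff_comp_const_sub hψ 0
  have hψ'c : HasCompactSupport ψ' := hasCompactSupport_comp_const_sub hc 0
  set w := conv f ψ' with hw
  have hwd : ContDiff ℝ ∞ w := contDiff_conv hf hψ's hψ'c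
  have key := abs_second_difference_le (u := fun s => w (s • v)) (M := c ^ 2 * (variation f U).toReal)
    ht (fun s => hasDerivAt_comp_smul_single (hwd.differentiable (by simp)) i c s)
    (fun s => (hasDerivAt_comp_smul_single ((contDiff_pderiv hwd i).differentiable (by simp))
      i c s).const_mul c) (by
      intro s hs'
      have := abs_pderiv_pderiv_conv_le hf hψ's hψ'c one_pos (fun x => h1 _) i i hfin (z := s • v)
        (fun y hy => hs s hs' y (by
          rw [hψ', tsupport_comp_const_sub] at hy
          simpa using hy))
      rw [one_mul] at this
      rw [← mul_assoc, abs_mul, abs_mul_self, ← pow_two]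
      gcongr)
  have hval : ∀ z, w z = ∫ y, f y * ψ (y - z) := fun z => by
    simp [hw, conv, hψ']
  have hint : ∀ z, Integrable fun y => f y * ψ (y - z) := fun z =>
    hf.mul_bdd (c := 1) (hψ.continuous.comp (continuous_sub_right z)).aestronglyMeasurable
      (Filter.Eventually.of_forall fun y => h1 _)
  simp only [hval] at key
  rw [← integral_add_sub_two_mul (hint _) (hint _) (hint _)] at key
  convert! key using 3
  funext y
  simp only [zero_smul, sub_zero, neg_smul, sub_neg_eq_add]
  ring

theorem integral_comp_stretch {L : Euc n →ₗ[ℝ] ℝ} {v : Euc n} (hv : L v = 1) {t : ℝ} (ht : 0 < t)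
    {G : Euc n → ℝ} (hG : AEStronglyMeasurable G volume) :
    ∫ p, G (p + ((t - 1) * L p) • v) = t⁻¹ * ∫ y, G y := by
  set T : Euc n →ₗ[ℝ] Euc n := LinearMap.transvection L ((t - 1) • v) with hT
  have hdet : LinearMap.det T = t := by
    rw [hT, LinearMap.transvection.det, map_smul, hv, smul_eq_mul]
    ring
  have hTp : ∀ p, T p = p + ((t - 1) * L p) • v := fun p => by
    rw [hT, LinearMap.transvection.apply, smul_smul, mul_comm]
  have hmap := Measure.map_linearMap_addHaar_eq_smul_addHaar (volume : Measure (Euc n))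
    (f := T) (by rw [hdet]; exact ht.ne')
  have hTc : Continuous T := T.continuous_of_finiteDimensional
  have := integral_map (μ := (volume : Measure (Euc n))) (φ := T) hTc.measurable.aemeasurable
    (f := G) (by rw [hmap]; exact hG.smul_measure _)
  simp only [hTp] at this
  rw [← this, hmap, hdet, integral_smul_measure, abs_of_pos (inv_pos.mpr ht),
    ENNReal.toReal_ofReal (inv_pos.mpr ht).le, smul_eq_mul]

theorem integrable_ite_mul {L : Euc n →ₗ[ℝ] ℝ} {p q φ : Euc n → ℝ} (hp : Continuous p)
    (hq : Continuous q) (hφ : Continuous φ) (hc : HasCompactSupport φ) :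
    Integrable fun x => (if 0 < L x then p x else q x) * φ x := by
  have hL : Continuous L := L.continuous_of_finiteDimensional
  have hm : MeasurableSet {x | 0 < L x} := measurableSet_lt measurable_const hL.measurable
  have h1 : Integrable fun x => p x * φ x :=
    (hp.mul hφ).integrable_of_hasCompactSupport hc.mul_left
  have h2 : Integrable fun x => q x * φ x :=
    (hq.mul hφ).integrable_of_hasCompactSupport hc.mul_left
  convert! Integrable.piecewise hm h1.integrableOn h2.integrableOn using 2 with x
  simp only [piecewise, mem_ofPred_eq]
  split_ifs <;> rfl

/-- A function of finite Hessian variation that is affine on both sides of a hyperplane does not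
jump across it. -/
theorem affine_eq_of_variation_ne_top {f : Euc n → ℝ} (hf : Integrable f) {U : Set (Euc n)}
    (hU : IsOpen U) (hfin : variation f U ≠ ⊤) {ℓ a b : Euc n →ᵃ[ℝ] ℝ} (hℓ : ℓ.linear ≠ 0)
    (ha : ∀ᵐ x, x ∈ U → 0 < ℓ x → f x = a x) (hb : ∀ᵐ x, x ∈ U → ℓ x < 0 → f x = b x)
    {x₀ : Euc n} (hx₀ : x₀ ∈ U) (h0 : ℓ x₀ = 0) : a x₀ = b x₀ := by
  by_contra hab
  set L := ℓ.linear with hL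
  obtain ⟨i, hi⟩ : ∃ i, L (EuclideanSpace.single i 1) ≠ 0 := by
    by_contra! h
    apply hℓ
    ext v
    rw [eq_sum_single v, map_sum]
    simp [h]
  set c := (L (EuclideanSpace.single i 1))⁻¹ with hc
  set v : Euc n := c • EuclideanSpace.single i (1 : ℝ) with hv
  have hLv : L v = 1 := by rw [hv, map_smul, hc, smul_eq_mul, inv_mul_cancel₀ hi]
  have hLc : Continuous L := L.continuous_of_finiteDimensional
  have hac : Continuous a := a.continuous_of_finiteDimensional
  have hbc : Continuous b := b.continuous_of_finiteDimensional
  have hℓc : Continuous ℓ := ℓ.continuous_of_finiteDimensional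
  set P : Euc n → Euc n := fun p => p - L p • v with hP
  have hPc : Continuous P := by fun_prop
  have hPv : ∀ p (s : ℝ), P (p + s • v) = P p := fun p s => by
    simp only [hP, map_add, map_smul, hLv, smul_eq_mul, mul_one, add_smul]
    abel
  obtain ⟨ε, hε, hball⟩ := Metric.isOpen_iff.mp hU x₀ hx₀
  -- the bump function
  set N : Set (Euc n) := {p | L p ∈ Ioo (0 : ℝ) 1 ∧ ‖P p‖ < ε / 2 ∧
    0 < (a x₀ - b x₀) * (a (x₀ + P p) - b (x₀ + P p))} with hN
  have hNo : IsOpen N := by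
    refine (isOpen_Ioo.preimage hLc).inter (IsOpen.inter ?_ ?_)
    · exact isOpen_lt hPc.norm continuous_const
    · exact isOpen_lt (g := fun p => (a x₀ - b x₀) * (a (x₀ + P p) - b (x₀ + P p)))
        continuous_const (by fun_prop)
  set y₀ : Euc n := (1 / 2 : ℝ) • v with hy₀
  have hLy : L y₀ = 1 / 2 := by rw [hy₀, map_smul, hLv, smul_eq_mul, mul_one]
  have hPy : P y₀ = 0 := by
    change y₀ - L y₀ • v = 0
    rw [hLy, hy₀, sub_self]
  have hyN : y₀ ∈ N := by
    refine ⟨?_, ?_, ?_⟩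
    · rw [hLy]; norm_num
    · rw [hPy, norm_zero]; positivity
    · rw [hPy, add_zero]
      exact mul_self_pos.mpr (sub_ne_zero.mpr hab)
  obtain ⟨φ, hφN, hφc, hφs, hφr, hφ1⟩ :=
    exists_contDiff_tsupport_subset (n := (⊤ : ℕ∞)) (hNo.mem_nhds hyN)
  have hφ0 : ∀ x, 0 ≤ φ x := fun x => (hφr (mem_range_self x)).1
  have hφ1' : ∀ x, |φ x| ≤ 1 := fun x => by
    rw [abs_of_nonneg (hφ0 x)]
    exact (hφr (mem_range_self x)).2
  have hφcont : Continuous φ := hφs.continuous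
  set Φ : Euc n → ℝ := fun p => φ (p - v) + φ (p + v) - 2 * φ p with hΦ
  have hcm : HasCompactSupport fun p => φ (p - v) :=
    hφc.comp_homeomorph (Homeomorph.subRight v)
  have hcp : HasCompactSupport fun p => φ (p + v) :=
    hφc.comp_homeomorph (Homeomorph.addRight v)
  have hΦc : HasCompactSupport Φ := (hcm.add hcp).sub (HasCompactSupport.mul_left hφc)
  have hΦcont : Continuous Φ := by fun_prop
  set k : Euc n → ℝ := fun p => if 0 < L p then a (x₀ + P p) else b (x₀ + P p) with hk
  set m : Euc n → ℝ := fun p => if 0 < L p then L p * a.linear v else L p * b.linear v with hm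
  have hkint : ∀ {χ : Euc n → ℝ}, Continuous χ → HasCompactSupport χ →
      Integrable fun p => k p * χ p := fun h1 h2 =>
    integrable_ite_mul (by fun_prop) (by fun_prop) h1 h2
  have hmint : Integrable fun p => m p * Φ p :=
    integrable_ite_mul (by fun_prop) (by fun_prop) hΦcont hΦc
  set I₀ := ∫ p, k p * Φ p with hI₀
  set I₁ := ∫ p, m p * Φ p with hI₁
  -- rescaling in direction `v`
  have main : ∀ t : ℝ, 0 < t → 2 * t * ‖v‖ < ε / 2 →
      |I₀ + t * I₁| ≤ 2 * t * (c ^ 2 * (variation f U).toReal) := by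
    intro t ht htε
    set ψ : Euc n → ℝ := fun y => φ ((y - x₀) + ((t⁻¹ - 1) * L (y - x₀)) • v) with hψ
    have hψs : ContDiff ℝ ∞ ψ := by
      have : ContDiff ℝ ∞ L := (LinearMap.toContinuousLinearMap L).contDiff
      refine hφs.comp ?_
      fun_prop
    have hinv : ∀ y, y = x₀ + P (y - x₀ + ((t⁻¹ - 1) * L (y - x₀)) • v) +
        (t * L (y - x₀ + ((t⁻¹ - 1) * L (y - x₀)) • v)) • v := by
      intro y
      rw [hPv]
      simp only [hP, map_add, map_smul, hLv, smul_eq_mul, mul_one]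
      have : t * (L (y - x₀) + (t⁻¹ - 1) * L (y - x₀)) = L (y - x₀) := by
        field_simp
        ring
      rw [this]
      abel
    have hψt : ∀ y ∈ tsupport ψ, y - x₀ + ((t⁻¹ - 1) * L (y - x₀)) • v ∈ tsupport φ := by
      intro y hy
      exact tsupport_comp_subset_preimage φ
        (f := fun y => (y - x₀) + ((t⁻¹ - 1) * L (y - x₀)) • v) (by fun_prop) hy
    have hψc : HasCompactSupport ψ := by
      refine HasCompactSupport.intro
        (hφc.image (f := fun p => x₀ + P p + (t * L p) • v) (by fun_prop)) fun y hy => ?_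
      by_contra hne
      exact hy ⟨_, hψt y (subset_tsupport _ hne), (hinv y).symm⟩
    have hsupp : ∀ s ∈ Icc (-t) t, ∀ y, y - s • v ∈ tsupport ψ → y ∈ U := by
      intro s hs y hy
      have hp := hφN (hψt _ hy)
      have e := hinv (y - s • v)
      set p := (y - s • v) - x₀ + ((t⁻¹ - 1) * L ((y - s • v) - x₀)) • v with hpdef
      obtain ⟨hp1, hp2, -⟩ := hp
      apply hball
      rw [Metric.mem_ball, dist_eq_norm]
      have e2 : y - x₀ = P p + (t * L p + s) • v := by
        rw [add_smul]
        rw [sub_eq_iff_eq_add] at e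
        rw [e]
        abel
      rw [e2]
      have hb : |t * L p + s| ≤ 2 * t := by
        have h1 : t * L p ≤ t * 1 := by gcongr; exact hp1.2.le
        have h2 : 0 ≤ t * L p := mul_nonneg ht.le hp1.1.le
        rw [abs_le]
        constructor <;> linarith [hs.1, hs.2]
      calc ‖P p + (t * L p + s) • v‖ ≤ ‖P p‖ + |t * L p + s| * ‖v‖ := by
            refine (norm_add_le _ _).trans ?_
            rw [norm_smul, Real.norm_eq_abs]
        _ ≤ ‖P p‖ + 2 * t * ‖v‖ := by gcongr
        _ < ε := by linarith
    have hbound := abs_integral_mul_second_difference_le hf hfin hψs hψc (fun x => hφ1' _) i c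
      ht.le hsupp
    rw [← hv] at hbound
    set Ψ : Euc n → ℝ := fun y => ψ (y - t • v) + ψ (y + t • v) - 2 * ψ y with hΨ
    set u : Euc n → ℝ := fun y => if 0 < ℓ y then a y else b y with hu
    have hΨU : ∀ y, y ∉ U → Ψ y = 0 := by
      intro y hy
      have h1 : ψ (y - t • v) = 0 := image_eq_zero_of_notMem_tsupport fun h =>
        hy (hsupp t ⟨by linarith, le_rfl⟩ y h)
      have h2 : ψ (y + t • v) = 0 := image_eq_zero_of_notMem_tsupport fun h =>
        hy (hsupp (-t) ⟨le_rfl, by linarith⟩ y (by simpa using h))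
      have h3 : ψ y = 0 := image_eq_zero_of_notMem_tsupport fun h =>
        hy (hsupp 0 ⟨by linarith, ht.le⟩ y (by simpa using h))
      simp only [hΨ, h1, h2, h3]
      ring
    have hfu : ∫ y, f y * Ψ y = ∫ y, u y * Ψ y := by
      refine integral_congr_ae ?_
      filter_upwards [ha, hb, ae_affine_ne_zero hℓ] with y h1 h2 h3
      by_cases hy : y ∈ U
      · rcases lt_or_gt_of_ne h3 with h | h
        · simp only [hu, h2 hy h, if_neg h.not_gt]
        · simp only [hu, h1 hy h, if_pos h]
      · rw [hΨU y hy, mul_zero, mul_zero]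
    have hum : Measurable u := Measurable.ite
      (measurableSet_lt measurable_const hℓc.measurable) hac.measurable hbc.measurable
    have hψcont : Continuous ψ := hψs.continuous
    have hΨcont : Continuous Ψ := by fun_prop
    have hcv : ∫ y, u y * Ψ y = t * (I₀ + t * I₁) := by
      have h1 : ∫ y, u y * Ψ y = ∫ y, u (x₀ + y) * Ψ (x₀ + y) :=
        (integral_add_left_eq_self (fun y => u y * Ψ y) x₀).symm
      have h2 := integral_comp_stretch hLv ht (G := fun y => u (x₀ + y) * Ψ (x₀ + y))
        ((hum.comp (measurable_const_add x₀)).mul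
          (hΨcont.comp (continuous_const_add x₀)).measurable).aestronglyMeasurable
      rw [h1]
      have h3 : ∀ p, u (x₀ + (p + ((t - 1) * L p) • v)) * Ψ (x₀ + (p + ((t - 1) * L p) • v)) =
          k p * Φ p + t * (m p * Φ p) := by
        intro p
        have e0 : x₀ + (p + ((t - 1) * L p) • v) = x₀ + P p + (t * L p) • v := by
          simp only [hP, sub_mul, sub_smul, one_mul]
          abel
        have hψp : ∀ s : ℝ, ψ (x₀ + P p + (t * L p) • v + (t * s) • v) = φ (p + s • v) := by
          intro s
          simp only [hψ]
          congr 1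
          have e1 : x₀ + P p + (t * L p) • v + (t * s) • v - x₀ = P p + (t * L p + t * s) • v := by
            rw [add_smul]
            abel
          have e2 : L (P p + (t * L p + t * s) • v) = t * L p + t * s := by
            simp [hP, hLv]
          rw [e1, e2]
          have e3 : (t⁻¹ - 1) * (t * L p + t * s) = L p + s - (t * L p + t * s) := by
            field_simp
          rw [e3, sub_smul]
          simp only [hP, add_smul]
          abel
        have e4 : Ψ (x₀ + P p + (t * L p) • v) = Φ p := by
          have q1 := hψp (-1)
          have q2 := hψp 1
          have q3 := hψp 0
          simp only [mul_neg, mul_one, neg_smul, one_smul, mul_zero, zero_smul, add_zero,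
            ← sub_eq_add_neg] at q1 q2 q3
          simp only [hΨ, hΦ, q1, q2, q3]
        have e5 : ℓ (x₀ + P p + (t * L p) • v) = t * L p := by
          have := ℓ.map_vadd x₀ (P p + (t * L p) • v)
          rw [h0] at this
          have e : x₀ + P p + (t * L p) • v = (P p + (t * L p) • v) +ᵥ x₀ := by
            rw [vadd_eq_add]; abel
          rw [e, this]
          simp [hP, hLv, ← hL]
        have e6 : ∀ d : Euc n →ᵃ[ℝ] ℝ, d (x₀ + P p + (t * L p) • v) =
            d (x₀ + P p) + t * (L p * d.linear v) := fun d => by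
          have := d.map_vadd (x₀ + P p) ((t * L p) • v)
          rw [vadd_eq_add, add_comm] at this
          rw [this]
          simp only [map_smul, smul_eq_mul, vadd_eq_add]
          ring
        rw [e0, e4, hu]
        simp only [e5, e6, hk, hm]
        by_cases hp : 0 < L p
        · rw [if_pos hp, if_pos hp, if_pos (mul_pos ht hp)]
          ring
        · rw [if_neg hp, if_neg hp, if_neg fun h => hp (pos_of_mul_pos_right h ht.le)]
          ring
      simp only [h3] at h2
      rw [integral_add (hkint hΦcont hΦc) (hmint.const_mul t), integral_const_mul] at h2
      rw [h2]
      field_simp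
    rw [hfu, hcv, abs_mul, abs_of_pos ht] at hbound
    have : t * |I₀ + t * I₁| ≤ t * (2 * t * (c ^ 2 * (variation f U).toReal)) := by
      calc _ ≤ _ := hbound
        _ = _ := by ring
    exact le_of_mul_le_mul_left this ht
  have hI0 : I₀ = 0 := by
    have hlim : Filter.Tendsto (fun t : ℝ => |I₀ + t * I₁|) (𝓝[>] 0) (𝓝 |I₀ + 0 * I₁|) :=
      (Continuous.tendsto (by fun_prop) 0).mono_left nhdsWithin_le_nhds
    have hlim2 : Filter.Tendsto (fun t : ℝ => 2 * t * (c ^ 2 * (variation f U).toReal)) (𝓝[>] 0)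
        (𝓝 (2 * 0 * (c ^ 2 * (variation f U).toReal))) :=
      (Continuous.tendsto (by fun_prop) 0).mono_left nhdsWithin_le_nhds
    have hlim3 : Filter.Tendsto (fun t : ℝ => 2 * t * ‖v‖) (𝓝[>] 0) (𝓝 (2 * 0 * ‖v‖)) :=
      (Continuous.tendsto (by fun_prop) 0).mono_left nhdsWithin_le_nhds
    have h := le_of_tendsto_of_tendsto hlim hlim2 (by
      filter_upwards [self_mem_nhdsWithin,
        hlim3.eventually_lt_const (u := ε / 2) (by simpa using hε)] with t ht ht'
      exact main t ht ht')
    simpa using h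
  -- the integral is that of a function of constant sign
  have hI0' : I₀ = ∫ p, (b (x₀ + P p) - a (x₀ + P p)) * φ p := by
    have s1 : ∫ p, k p * φ (p - v) = ∫ p, k (p + v) * φ p := by
      rw [← integral_add_right_eq_self _ v]
      simp
    have s2 : ∫ p, k p * φ (p + v) = ∫ p, k (p - v) * φ p := by
      rw [← integral_sub_right_eq_self _ v]
      simp
    have hi1 := hkint (χ := fun p => φ (p - v)) (by fun_prop) hcm
    have hi2 := hkint (χ := fun p => φ (p + v)) (by fun_prop) hcp
    have hi3 := hkint hφcont hφc
    have j1 : Integrable fun p => k (p + v) * φ p := by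
      have := hi1.comp_add_right v
      simpa using this
    have j2 : Integrable fun p => k (p - v) * φ p := by
      have := hi2.comp_sub_right v
      simpa using this
    have : I₀ = (∫ p, k p * φ (p - v)) + (∫ p, k p * φ (p + v)) - 2 * ∫ p, k p * φ p := by
      rw [← integral_add_sub_two_mul hi1 hi2 hi3, hI₀]
      refine integral_congr_ae (Filter.Eventually.of_forall fun p => ?_)
      simp only [hΦ]
      ring
    rw [this, s1, s2, ← integral_add_sub_two_mul j1 j2 hi3]
    refine integral_congr_ae (Filter.Eventually.of_forall fun p => ?_)
    by_cases hp : p ∈ tsupport φ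
    · obtain ⟨⟨hp1, hp2⟩, -⟩ := hφN hp
      have e1 : P (p + v) = P p := by simpa using hPv p 1
      have e2 : P (p - v) = P p := by simpa [← sub_eq_add_neg] using hPv p (-1)
      have l1 : 0 < L (p + v) := by rw [map_add, hLv]; linarith
      have l2 : ¬ 0 < L (p - v) := by rw [map_sub, hLv]; linarith
      simp only [hk, if_pos l1, if_neg l2, if_pos hp1, e1, e2]
      ring
    · simp [image_eq_zero_of_notMem_tsupport hp]
  have hpos : 0 < ∫ p, (a x₀ - b x₀) * (a (x₀ + P p) - b (x₀ + P p)) * φ p := by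
    refine Continuous.integral_pos_of_hasCompactSupport_nonneg_nonzero (x := y₀) (by fun_prop)
      hφc.mul_left (fun p => ?_) ?_
    · by_cases hp : p ∈ tsupport φ
      · exact mul_nonneg (hφN hp).2.2.le (hφ0 p)
      · simp [image_eq_zero_of_notMem_tsupport hp]
    · rw [hφ1, mul_one]
      exact hyN.2.2.ne'
  have : ∫ p, (a x₀ - b x₀) * (a (x₀ + P p) - b (x₀ + P p)) * φ p = -(a x₀ - b x₀) * I₀ := by
    rw [hI0', ← integral_const_mul]
    refine integral_congr_ae (Filter.Eventually.of_forall fun p => ?_)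
    simp only
    ring
  rw [this, hI0, mul_zero] at hpos
  exact lt_irrefl _ hpos

end NoJump

section DerivBound

variable {n : ℕ} {f : Euc n → ℝ} {A B : Set (Euc n)} {K : ℝ}

/-- The distributional first partial derivatives of `f` on `A` are bounded by `K`. -/
def DerivBound (f : Euc n → ℝ) (K : ℝ) (A : Set (Euc n)) : Prop :=
  ∀ φ : Euc n → ℝ, ContDiff ℝ ∞ φ → HasCompactSupport φ → tsupport φ ⊆ A →
    ∀ i, |∫ x, f x * pderiv i φ x| ≤ K * ∫ x, |φ x|

theorem derivBound_of_lipschitzWith {u : Euc n → ℝ} {C : NNReal} (hu : LipschitzWith C u)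
    (h : ∀ᵐ x, x ∈ A → f x = u x) : DerivBound f C A := by
  intro φ hφ hc hs i
  set e : Euc n := EuclideanSpace.single i 1 with he
  have hne : ‖e‖ = 1 := by simp [he]
  obtain ⟨D, hD⟩ := ContDiff.lipschitzWith_of_hasCompactSupport hc hφ (by simp)
  have hline : ∀ x, lineDeriv ℝ φ x (-e) = - pderiv i φ x := fun x => by
    rw [(hφ.differentiable (by simp) x).lineDeriv_eq_fderiv, map_neg, pderiv]
  have key := LipschitzWith.integral_lineDeriv_mul_eq (μ := (volume : Measure (Euc n))) hu hD hc e
  have h1 : ∫ x, f x * pderiv i φ x = - ∫ x, lineDeriv ℝ u x e * φ x := by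
    rw [key, ← integral_neg]
    refine integral_congr_ae ?_
    filter_upwards [h] with x hx
    rw [hline]
    by_cases hxA : x ∈ A
    · rw [hx hxA]; ring
    · rw [pderiv_eq_zero_of_notMem_tsupport fun hx' => hxA (hs hx')]; ring
  rw [h1, abs_neg, ← integral_const_mul]
  refine (abs_integral_le_integral_abs).trans (integral_mono_of_nonneg
    (Filter.Eventually.of_forall fun x => abs_nonneg _)
    ((hφ.continuous.abs.integrable_of_hasCompactSupport hc.abs).const_mul _)
    (Filter.Eventually.of_forall fun x => ?_))
  simp only [abs_mul]
  gcongr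
  simpa [hne] using norm_lineDeriv_le_of_lipschitz ℝ hu (x₀ := x) (v := e)

theorem integrable_mul_pderiv (hf : Integrable f) {φ : Euc n → ℝ} (hφ : ContDiff ℝ ∞ φ)
    (hc : HasCompactSupport φ) (i : Fin n) : Integrable fun x => f x * pderiv i φ x := by
  obtain ⟨C, hC⟩ := (contDiff_pderiv hφ i).continuous.bounded_above_of_compact_support
    (hasCompactSupport_pderiv hc i)
  exact hf.mul_bdd (contDiff_pderiv hφ i).continuous.aestronglyMeasurable
    (Filter.Eventually.of_forall hC)

theorem tsupport_mul_subset_of_eventually {η φ : Euc n → ℝ} (hs : tsupport φ ⊆ A)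
    (h : ∀ x ∈ A, x ∉ B → ∀ᶠ y in 𝓝 x, η y = 0) : tsupport (fun x => η x * φ x) ⊆ B := by
  intro x hx
  have hxA : x ∈ A := hs (tsupport_mul_subset_right (f := η) hx)
  by_contra hxB
  refine notMem_tsupport_iff_eventuallyEq.mpr ?_ hx
  filter_upwards [h x hxA hxB] with y hy
  simp [hy]

theorem pderiv_eq_add_of_cutoff {η φ : Euc n → ℝ} (hη : ContDiff ℝ ∞ η) (hφ : ContDiff ℝ ∞ φ)
    (i : Fin n) (x : Euc n) : pderiv i φ x =
      pderiv i (fun x => η x * φ x) x + pderiv i (fun x => (1 - η x) * φ x) x := by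
  have h := congrFun (pderiv_add (hη.mul hφ) ((contDiff_const (c := (1 : ℝ))).sub hη |>.mul hφ) i) x
  rw [← h]
  congr 1
  funext y
  ring

theorem DerivBound.mono (h : DerivBound f K B) (hAB : A ⊆ B) : DerivBound f K A :=
  fun φ hφ hc hs i => h φ hφ hc (hs.trans hAB) i

theorem DerivBound.of_le (h : DerivBound f K A) {K' : ℝ} (hK : K ≤ K') : DerivBound f K' A :=
  fun φ hφ hc hs i => (h φ hφ hc hs i).trans (by
    have : 0 ≤ ∫ x, |φ x| := integral_nonneg fun x => abs_nonneg _
    gcongr)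

theorem DerivBound.add {g : Euc n → ℝ} {K' : ℝ} (hf : Integrable f) (hg : Integrable g)
    (h : DerivBound f K A) (h' : DerivBound g K' A) : DerivBound (f + g) (K + K') A := by
  intro φ hφ hc hs i
  have : ∫ x, (f + g) x * pderiv i φ x =
      (∫ x, f x * pderiv i φ x) + ∫ x, g x * pderiv i φ x := by
    rw [← integral_add (integrable_mul_pderiv hf hφ hc i) (integrable_mul_pderiv hg hφ hc i)]
    simp [add_mul]
  rw [this, add_mul]
  exact (abs_add_le _ _).trans (add_le_add (h φ hφ hc hs i) (h' φ hφ hc hs i))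

theorem DerivBound.const_smul (h : DerivBound f K A) (c : ℝ) :
    DerivBound (c • f) (|c| * K) A := by
  intro φ hφ hc hs i
  have : ∫ x, (c • f) x * pderiv i φ x = c * ∫ x, f x * pderiv i φ x := by
    rw [← integral_const_mul]
    simp [mul_assoc]
  rw [this, abs_mul, mul_assoc]
  gcongr
  exact h φ hφ hc hs i

theorem DerivBound.union (hf : Integrable f) (hA : IsOpen A) (hB : IsOpen B)
    (h : DerivBound f K A) (h' : DerivBound f K B) : DerivBound f K (A ∪ B) := by
  intro φ hφ hc hs i
  have hdis : Disjoint (tsupport φ \ A) (tsupport φ \ B) := by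
    rw [disjoint_left]
    rintro x ⟨hx, hxA⟩ ⟨-, hxB⟩
    exact (hs hx).elim hxA hxB
  obtain ⟨η, hη, h0, h1, h01⟩ := exists_smooth_cutoff ((isClosed_tsupport φ).sdiff hA)
    ((isClosed_tsupport φ).sdiff hB) hdis
  have hη' : ContDiff ℝ ∞ fun x => 1 - η x := contDiff_const.sub hη
  have hφ1 := hη.mul hφ
  have hφ2 := hη'.mul hφ
  have hc1 : HasCompactSupport fun x => η x * φ x := HasCompactSupport.mul_left (f := η) hc
  have hc2 : HasCompactSupport fun x => (1 - η x) * φ x :=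
    HasCompactSupport.mul_left (f := fun x => 1 - η x) hc
  have b1 := h _ hφ1 hc1 (tsupport_mul_subset_of_eventually (A := tsupport φ) Subset.rfl
    fun x hx hxA => h0 x ⟨hx, hxA⟩) i
  have b2 := h' _ hφ2 hc2 (tsupport_mul_subset_of_eventually (A := tsupport φ) Subset.rfl
    fun x hx hxA => by
      filter_upwards [h1 x ⟨hx, hxA⟩] with y hy
      rw [hy, sub_self]) i
  have e : ∫ x, f x * pderiv i φ x = (∫ x, f x * pderiv i (fun x => η x * φ x) x) +
      ∫ x, f x * pderiv i (fun x => (1 - η x) * φ x) x := by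
    rw [← integral_add (integrable_mul_pderiv hf hφ1 hc1 i) (integrable_mul_pderiv hf hφ2 hc2 i)]
    refine integral_congr_ae (Filter.Eventually.of_forall fun x => ?_)
    simp only
    rw [pderiv_eq_add_of_cutoff hη hφ i x, mul_add]
  have e2 : ∫ x, |φ x| = (∫ x, |η x * φ x|) + ∫ x, |(1 - η x) * φ x| := by
    rw [← integral_add (hφ1.continuous.abs.integrable_of_hasCompactSupport hc1.abs)
      (hφ2.continuous.abs.integrable_of_hasCompactSupport hc2.abs)]
    refine integral_congr_ae (Filter.Eventually.of_forall fun x => ?_)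
    simp only [abs_mul]
    rw [abs_of_nonneg (h01 x).1, abs_of_nonneg (sub_nonneg.mpr (h01 x).2)]
    ring
  rw [e, e2, mul_add]
  exact (abs_add_le _ _).trans (add_le_add b1 b2)

theorem DerivBound.biUnion {ι : Type*} (hf : Integrable f) (s : Finset ι) {U : ι → Set (Euc n)}
    (hU : ∀ i, IsOpen (U i)) (h : ∀ i, DerivBound f K (U i)) :
    DerivBound f K (⋃ i ∈ s, U i) := by
  classical
  induction s using Finset.induction_on with
  | empty =>
    intro φ hφ hc hs i
    have : tsupport φ = ∅ := by simpa using hs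
    have h0 : ∀ x, x ∉ tsupport φ := fun x => by rw [this]; exact notMem_empty x
    simp [pderiv_eq_zero_of_notMem_tsupport (h0 _), image_eq_zero_of_notMem_tsupport (h0 _)]
  | insert a s ha ih =>
    rw [Finset.set_biUnion_insert]
    exact (h a).union hf (hU a) (isOpen_biUnion fun i _ => hU i) ih

end DerivBound

section Thin

variable {n : ℕ}

/-- Sets admitting smooth cutoffs whose gradients are arbitrarily small in `L¹`. -/
def IsThin (Z : Set (Euc n)) : Prop :=
  ∀ R M ε : ℝ, 0 < ε → ∃ χ : Euc n → ℝ, ContDiff ℝ ∞ χ ∧ (∀ x, χ x ∈ Icc (0 : ℝ) 1) ∧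
    (∀ x ∈ Z, ∀ᶠ y in 𝓝 x, χ y = 1) ∧
    ∀ φ : Euc n → ℝ, ContDiff ℝ ∞ φ → tsupport φ ⊆ Metric.closedBall 0 R → (∀ x, |φ x| ≤ M) →
      (∀ i x, |pderiv i φ x| ≤ M) → ∀ i, ∫ x, |pderiv i (fun x => χ x * φ x) x| ≤ ε

theorem isThin_empty : IsThin (∅ : Set (Euc n)) := by
  intro R M ε hε
  refine ⟨fun _ => 0, contDiff_const, by simp, by simp, fun φ _ _ _ _ i => ?_⟩
  simp [pderiv, hε.le]

variable {Z A : Set (Euc n)} {f : Euc n → ℝ} {K : ℝ}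

theorem eventually_one_sub_eq_zero {χ : Euc n → ℝ} (h1 : ∀ x ∈ Z, ∀ᶠ y in 𝓝 x, χ y = 1)
    (x : Euc n) (hx : x ∈ A) (hxZ : x ∉ A \ Z) : ∀ᶠ y in 𝓝 x, 1 - χ y = 0 := by
  have : x ∈ Z := by
    by_contra h
    exact hxZ ⟨hx, h⟩
  filter_upwards [h1 x this] with y hy
  rw [hy, sub_self]

theorem DerivBound.of_diff_isThin (hf : Integrable f) (hK : 0 ≤ K) {M : ℝ}
    (hM : ∀ᵐ x, |f x| ≤ M) (hZ : IsThin Z) (h : DerivBound f K (A \ Z)) : DerivBound f K A := by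
  intro φ hφ hc hs i
  obtain ⟨R, hR⟩ := hc.isCompact.isBounded.subset_closedBall 0
  obtain ⟨C, hC⟩ := hφ.continuous.bounded_above_of_compact_support hc
  have hC' : ∀ j, ∃ C', ∀ x, ‖pderiv j φ x‖ ≤ C' := fun j =>
    (contDiff_pderiv hφ j).continuous.bounded_above_of_compact_support
      (hasCompactSupport_pderiv hc j)
  choose C' hC' using hC'
  set N := |C| + ∑ j, |C' j| with hN
  have hN1 : ∀ x, |φ x| ≤ N := fun x => (hC x).trans ((le_abs_self C).trans
    (le_add_of_nonneg_right (Finset.sum_nonneg fun _ _ => abs_nonneg _)))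
  have hN2 : ∀ j x, |pderiv j φ x| ≤ N := fun j x => (hC' j x).trans ((le_abs_self _).trans
    ((Finset.single_le_sum (f := fun j => |C' j|) (fun _ _ => abs_nonneg _)
      (Finset.mem_univ j)).trans (le_add_of_nonneg_left (abs_nonneg _))))
  refine le_of_forall_pos_le_add fun ε hε => ?_
  obtain ⟨χ, hχ, h01, h1, hb⟩ := hZ R N (ε / (|M| + 1)) (by positivity)
  have hχ' : ContDiff ℝ ∞ fun x => 1 - χ x := contDiff_const.sub hχ
  have hφ1 := hχ.mul hφ
  have hφ2 := hχ'.mul hφ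
  have hc1 : HasCompactSupport fun x => χ x * φ x := HasCompactSupport.mul_left (f := χ) hc
  have hc2 : HasCompactSupport fun x => (1 - χ x) * φ x :=
    HasCompactSupport.mul_left (f := fun x => 1 - χ x) hc
  have b2 := h _ hφ2 hc2 (tsupport_mul_subset_of_eventually hs
    (eventually_one_sub_eq_zero h1)) i
  have e : ∫ x, f x * pderiv i φ x = (∫ x, f x * pderiv i (fun x => χ x * φ x) x) +
      ∫ x, f x * pderiv i (fun x => (1 - χ x) * φ x) x := by
    rw [← integral_add (integrable_mul_pderiv hf hφ1 hc1 i) (integrable_mul_pderiv hf hφ2 hc2 i)]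
    refine integral_congr_ae (Filter.Eventually.of_forall fun x => ?_)
    simp only
    rw [pderiv_eq_add_of_cutoff hχ hφ i x, mul_add]
  have b1 : |∫ x, f x * pderiv i (fun x => χ x * φ x) x| ≤ ε := by
    calc _ ≤ ∫ x, |f x * pderiv i (fun x => χ x * φ x) x| := abs_integral_le_integral_abs
      _ ≤ ∫ x, (|M| + 1) * |pderiv i (fun x => χ x * φ x) x| := by
          refine integral_mono_ae (integrable_mul_pderiv hf hφ1 hc1 i).abs
            (((contDiff_pderiv hφ1 i).continuous.abs.integrable_of_hasCompactSupport
              (hasCompactSupport_pderiv hc1 i).abs).const_mul _) ?_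
          filter_upwards [hM] with x hx
          simp only [abs_mul]
          gcongr
          exact hx.trans ((le_abs_self M).trans (by linarith))
      _ ≤ (|M| + 1) * (ε / (|M| + 1)) := by
          rw [integral_const_mul]
          gcongr
          exact hb φ hφ hR hN1 hN2 i
      _ = ε := by field_simp
  have b3 : ∫ x, |(1 - χ x) * φ x| ≤ ∫ x, |φ x| := by
    refine integral_mono (hφ2.continuous.abs.integrable_of_hasCompactSupport hc2.abs)
      (hφ.continuous.abs.integrable_of_hasCompactSupport hc.abs) fun x => ?_
    simp only [abs_mul]
    refine mul_le_of_le_one_left (abs_nonneg _) ?_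
    rw [abs_of_nonneg (sub_nonneg.mpr (h01 x).2)]
    linarith [(h01 x).1]
  rw [e]
  calc _ ≤ _ := abs_add_le _ _
    _ ≤ ε + K * ∫ x, |φ x| := by
        refine add_le_add b1 (b2.trans ?_)
        gcongr
    _ = _ := add_comm _ _

theorem variation_le_variation_diff_isThin (hf : Integrable f) (hZ : IsThin Z) (hK : 0 ≤ K)
    (h : DerivBound f K A) : variation f A ≤ variation f (A \ Z) := by
  refine variation_le fun F hF => ?_
  rcases eq_or_ne (variation f (A \ Z)) ⊤ with htop | htop
  · rw [htop]; exact le_top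
  rw [← ENNReal.ofReal_toReal htop]
  refine ENNReal.ofReal_le_ofReal (le_of_forall_pos_le_add fun ε hε => ?_)
  have hKc : IsCompact (⋃ i, ⋃ j, tsupport (fun y => F y i j)) :=
    isCompact_iUnion fun i => isCompact_iUnion fun j => hF.compact i j
  obtain ⟨R, hR⟩ := hKc.isBounded.subset_closedBall 0
  have hR' : ∀ i j, tsupport (fun y => F y i j) ⊆ Metric.closedBall 0 R := fun i j =>
    ((subset_iUnion (fun j => tsupport (fun y => F y i j)) j).trans
      (subset_iUnion (fun i => ⋃ j, tsupport (fun y => F y i j)) i)).trans hR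
  have hC1 : ∀ i j, ∃ C, ∀ x, ‖F x i j‖ ≤ C := fun i j =>
    (hF.smooth i j).continuous.bounded_above_of_compact_support (hF.compact i j)
  have hC2 : ∀ i j k, ∃ C, ∀ x, ‖pderiv k (fun x => F x i j) x‖ ≤ C := fun i j k =>
    (contDiff_pderiv (hF.smooth i j) k).continuous.bounded_above_of_compact_support
      (hasCompactSupport_pderiv (hF.compact i j) k)
  choose C hC using hC1
  choose D hD using hC2
  set N := (∑ i, ∑ j, |C i j|) + ∑ i, ∑ j, ∑ k, |D i j k| with hN
  have hN1 : ∀ i j x, |F x i j| ≤ N := fun i j x => by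
    refine (hC i j x).trans ((le_abs_self _).trans ?_)
    have h1 : |C i j| ≤ ∑ j, |C i j| := Finset.single_le_sum (f := fun j => |C i j|)
      (fun _ _ => abs_nonneg _) (Finset.mem_univ j)
    have h2 : ∑ j, |C i j| ≤ ∑ i, ∑ j, |C i j| := Finset.single_le_sum
      (f := fun i => ∑ j, |C i j|) (fun _ _ => by positivity) (Finset.mem_univ i)
    have h3 : 0 ≤ ∑ i, ∑ j, ∑ k, |D i j k| := by positivity
    linarith
  have hN2 : ∀ i j k x, |pderiv k (fun x => F x i j) x| ≤ N := fun i j k x => by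
    refine (hD i j k x).trans ((le_abs_self _).trans ?_)
    have h0 : |D i j k| ≤ ∑ k, |D i j k| := Finset.single_le_sum (f := fun k => |D i j k|)
      (fun _ _ => abs_nonneg _) (Finset.mem_univ k)
    have h1 : ∑ k, |D i j k| ≤ ∑ j, ∑ k, |D i j k| := Finset.single_le_sum
      (f := fun j => ∑ k, |D i j k|) (fun _ _ => by positivity) (Finset.mem_univ j)
    have h2 : ∑ j, ∑ k, |D i j k| ≤ ∑ i, ∑ j, ∑ k, |D i j k| := Finset.single_le_sum
      (f := fun i => ∑ j, ∑ k, |D i j k|) (fun _ _ => by positivity) (Finset.mem_univ i)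
    have h3 : 0 ≤ ∑ i, ∑ j, |C i j| := by positivity
    linarith
  obtain ⟨χ, hχ, h01, h1, hb⟩ := hZ R N (ε / ((n : ℝ) * n * K + 1)) (by positivity)
  have hF1 : IsTestField A (fun x => χ x • F x) := hF.smul hχ
    (fun x => abs_le.mpr ⟨by linarith [(h01 x).1], (h01 x).2⟩) (fun x hx hx' => absurd hx hx')
  have hF2 : IsTestField (A \ Z) (fun x => (1 - χ x) • F x) := hF.smul (contDiff_const.sub hχ)
    (fun x => abs_le.mpr ⟨by linarith [(h01 x).2], by linarith [(h01 x).1]⟩)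
    (eventually_one_sub_eq_zero h1)
  have hsum : F = (fun x => χ x • F x) + fun x => (1 - χ x) • F x := by
    funext x
    simp [← add_smul]
  have e : ∫ x, f x * ddiv F x = (∫ x, f x * ddiv (fun x => χ x • F x) x) +
      ∫ x, f x * ddiv (fun x => (1 - χ x) • F x) x := by
    rw [← integral_add (hF1.integrable hf) (hF2.integrable hf)]
    refine integral_congr_ae (Filter.Eventually.of_forall fun x => ?_)
    have h := hF1.ddiv_add hF2 x
    rw [← hsum] at h
    simp only [h, mul_add]
  have b2 : ∫ x, f x * ddiv (fun x => (1 - χ x) • F x) x ≤ (variation f (A \ Z)).toReal :=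
    (ENNReal.ofReal_le_iff_le_toReal htop).mp (ofReal_le_variation hF2 f)
  have b1 : ∫ x, f x * ddiv (fun x => χ x • F x) x ≤ ε := by
    have hint : ∀ i j, Integrable fun x =>
        f x * pderiv i (pderiv j (fun y => (χ y • F y) i j)) x := fun i j =>
      integrable_mul_pderiv hf (contDiff_pderiv (hF1.smooth i j) j)
        (hasCompactSupport_pderiv (hF1.compact i j) j) i
    simp only [ddiv, Finset.mul_sum]
    rw [integral_finsetSum _ fun i _ => integrable_finsetSum _ fun j _ => hint i j]
    have hle : ∀ i j, ∫ x, f x * pderiv i (pderiv j (fun y => (χ y • F y) i j)) x ≤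
        K * (ε / ((n : ℝ) * n * K + 1)) := fun i j => by
      refine (le_abs_self _).trans ((h _ (contDiff_pderiv (hF1.smooth i j) j)
        (hasCompactSupport_pderiv (hF1.compact i j) j)
        ((tsupport_pderiv _ j).trans (hF1.support i j)) i).trans ?_)
      gcongr
      exact hb _ (hF.smooth i j) (hR' i j) (hN1 i j) (hN2 i j) j
    calc _ ≤ ∑ _i : Fin n, ∑ _j : Fin n, K * (ε / ((n : ℝ) * n * K + 1)) := by
          refine Finset.sum_le_sum fun i _ => ?_
          rw [integral_finsetSum _ fun j _ => hint i j]
          exact Finset.sum_le_sum fun j _ => hle i j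
      _ = (n : ℝ) * n * K * ε / ((n : ℝ) * n * K + 1) := by
          simp
          ring
      _ ≤ ε := by
          rw [div_le_iff₀ (by positivity)]
          nlinarith
  rw [e]
  linarith

theorem DerivBound.of_diff_biUnion {ι : Type*} (hf : Integrable f) (hK : 0 ≤ K) {M : ℝ}
    (hM : ∀ᵐ x, |f x| ≤ M) (s : Finset ι) {Z : ι → Set (Euc n)} (hZ : ∀ i ∈ s, IsThin (Z i))
    (h : DerivBound f K (A \ ⋃ i ∈ s, Z i)) : DerivBound f K A := by
  classical
  induction s using Finset.induction_on with
  | empty => simpa using h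
  | insert a s ha ih =>
    refine ih (fun i hi => hZ i (Finset.mem_insert_of_mem hi)) ?_
    refine DerivBound.of_diff_isThin hf hK hM (hZ a (Finset.mem_insert_self a s)) ?_
    rwa [sdiff_sdiff, union_comm, ← Finset.set_biUnion_insert]

theorem variation_le_variation_diff_biUnion {ι : Type*} (hf : Integrable f) (s : Finset ι)
    {Z : ι → Set (Euc n)} (hZ : ∀ i ∈ s, IsThin (Z i)) (hK : 0 ≤ K) (h : DerivBound f K A) :
    variation f A ≤ variation f (A \ ⋃ i ∈ s, Z i) := by
  classical
  induction s using Finset.induction_on with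
  | empty => simp
  | insert a s ha ih =>
    refine (ih fun i hi => hZ i (Finset.mem_insert_of_mem hi)).trans ?_
    rw [Finset.set_biUnion_insert, union_comm, ← sdiff_sdiff]
    exact variation_le_variation_diff_isThin hf (hZ a (Finset.mem_insert_self a s)) hK
      (h.mono sdiff_subset)

end Thin

section Codimension

variable {n : ℕ}

theorem pderiv_mul {φ ψ : Euc n → ℝ} (hφ : ContDiff ℝ ∞ φ) (hψ : ContDiff ℝ ∞ ψ)
    (i : Fin n) (x : Euc n) :
    pderiv i (fun x => φ x * ψ x) x = φ x * pderiv i ψ x + ψ x * pderiv i φ x := by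
  simp only [pderiv]
  rw [fderiv_fun_mul (hφ.differentiable (by simp) x) (hψ.differentiable (by simp) x)]
  simp

theorem contDiff_affine (ℓ : Euc n →ᵃ[ℝ] ℝ) : ContDiff ℝ ∞ ℓ := by
  have : (ℓ : Euc n → ℝ) = fun x => LinearMap.toContinuousLinearMap ℓ.linear x + ℓ 0 := by
    funext x
    simpa using congrFun ℓ.decomp x
  rw [this]
  fun_prop

theorem fderiv_affine (ℓ : Euc n →ᵃ[ℝ] ℝ) (x v : Euc n) : fderiv ℝ ℓ x v = ℓ.linear v := by
  have : (ℓ : Euc n → ℝ) = fun x => LinearMap.toContinuousLinearMap ℓ.linear x + ℓ 0 := by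
    funext x
    simpa using congrFun ℓ.decomp x
  rw [this, fderiv_add_const, ContinuousLinearMap.fderiv]
  simp

theorem pderiv_comp_affine {θ : ℝ → ℝ} (hθ : Differentiable ℝ θ) (ℓ : Euc n →ᵃ[ℝ] ℝ) (c : ℝ)
    (i : Fin n) (x : Euc n) : pderiv i (fun x => θ (c * ℓ x)) x =
      deriv θ (c * ℓ x) * (c * ℓ.linear (EuclideanSpace.single i 1)) := by
  have h1 : HasFDerivAt (fun x => c * ℓ x) (c • fderiv ℝ ℓ x) x :=
    ((contDiff_affine ℓ).differentiable (by simp) x).hasFDerivAt.const_mul c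
  have h2 := (hθ (c * ℓ x)).hasDerivAt.comp_hasFDerivAt x h1
  rw [pderiv, HasFDerivAt.fderiv (f := fun x => θ (c * ℓ x)) h2]
  simp [fderiv_affine]

theorem exists_volume_slab_le {ℓ : Euc n →ᵃ[ℝ] ℝ} (hℓ : ℓ.linear ≠ 0) (R : ℝ) {ε : ℝ}
    (hε : 0 < ε) : ∃ δ₀ > 0, ∀ δ, 0 < δ → δ ≤ δ₀ →
      volume.real (Metric.closedBall (0 : Euc n) R ∩ {x | |ℓ x| ≤ δ}) ≤ ε := by
  set s : ℝ → Set (Euc n) := fun δ => Metric.closedBall (0 : Euc n) R ∩ {x | |ℓ x| ≤ δ} with hs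
  have hℓc : Continuous ℓ := ℓ.continuous_of_finiteDimensional
  have hsm : ∀ δ, MeasurableSet (s δ) := fun δ =>
    (Metric.isClosed_closedBall.inter (isClosed_le hℓc.abs continuous_const)).measurableSet
  have hfin : ∀ δ, volume (s δ) ≠ ⊤ := fun δ =>
    ((measure_mono inter_subset_left).trans_lt measure_closedBall_lt_top).ne
  have hlim := tendsto_measure_biInter_gt (μ := (volume : Measure (Euc n))) (s := s) (a := 0)
    (fun r _ => (hsm r).nullMeasurableSet)
    (fun i j _ hij x hx => ⟨hx.1, le_trans hx.2 hij⟩) ⟨1, one_pos, hfin 1⟩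
  have hzero : volume (⋂ r > (0 : ℝ), s r) = 0 := by
    refine measure_mono_null (fun x hx => ?_) (ae_iff.mp (ae_affine_ne_zero hℓ))
    simp only [mem_iInter] at hx
    simp only [not_not, mem_ofPred_eq]
    refine abs_nonpos_iff.mp (le_of_forall_pos_le_add fun η hη => ?_)
    simpa using (hx η hη).2
  rw [hzero] at hlim
  have := hlim.eventually_le_const (ENNReal.ofReal_pos.mpr hε)
  obtain ⟨δ₀, hδ₀, h⟩ := mem_nhdsGT_iff_exists_Ioc_subset.mp this
  exact ⟨δ₀, hδ₀, fun δ h0 h1 => ENNReal.toReal_le_of_le_ofReal hε.le (h ⟨h0, h1⟩)⟩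

theorem volume_inter_slab_le {ℓ m : Euc n →ᵃ[ℝ] ℝ} {v : Euc n} (hℓv : ℓ.linear v = 0)
    (hmv : m.linear v = 1) (R : ℝ) {δ : ℝ} (hδ : 0 < δ) (hδ1 : δ ≤ 1 / 8) :
    volume.real (Metric.closedBall (0 : Euc n) R ∩ {x | |ℓ x| ≤ δ ∧ |m x| ≤ δ}) ≤
      8 * δ * volume.real (Metric.closedBall (0 : Euc n) (R + ‖v‖) ∩ {x | |ℓ x| ≤ δ}) := by
  set S := Metric.closedBall (0 : Euc n) R ∩ {x | |ℓ x| ≤ δ ∧ |m x| ≤ δ} with hS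
  set S' := Metric.closedBall (0 : Euc n) (R + ‖v‖) ∩ {x | |ℓ x| ≤ δ} with hS'
  have hℓc : Continuous ℓ := ℓ.continuous_of_finiteDimensional
  have hmc : Continuous m := m.continuous_of_finiteDimensional
  have hSm : MeasurableSet S := (Metric.isClosed_closedBall.inter
    ((isClosed_le hℓc.abs continuous_const).inter
      (isClosed_le hmc.abs continuous_const))).measurableSet
  have hS'fin : volume S' ≠ ⊤ :=
    ((measure_mono inter_subset_left).trans_lt measure_closedBall_lt_top).ne
  set N := ⌊1 / (4 * δ)⌋₊ with hN
  have hN1 : (N : ℝ) ≤ 1 / (4 * δ) := Nat.floor_le (by positivity)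
  have hN2 : 1 / (8 * δ) ≤ (N : ℝ) := by
    have h1 := Nat.lt_floor_add_one (1 / (4 * δ))
    have h2 : 1 ≤ 1 / (8 * δ) := by
      rw [le_div_iff₀ (by positivity)]
      linarith
    have h3 : 1 / (4 * δ) = 1 / (8 * δ) + 1 / (8 * δ) := by field_simp; norm_num
    rw [← hN] at h1
    linarith
  set T : ℕ → Set (Euc n) := fun k => (fun x => x + (-(4 * δ * k)) • v) ⁻¹' S with hT
  have hTm : ∀ k, MeasurableSet (T k) := fun k => (measurable_add_const _) hSm
  have hTv : ∀ k, volume (T k) = volume S := fun k => measure_preimage_add_right _ _ _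
  have hmap : ∀ (d : Euc n →ᵃ[ℝ] ℝ) (x : Euc n) (c : ℝ), d (x + c • v) = d x + c * d.linear v := by
    intro d x c
    have := d.map_vadd x (c • v)
    rw [vadd_eq_add, add_comm] at this
    rw [this, map_smul, smul_eq_mul, vadd_eq_add, add_comm]
  have hTsub : ∀ k ∈ Finset.range N, T k ⊆ S' := by
    intro k hk x hx
    obtain ⟨hx1, hx2, -⟩ := hx
    rw [Metric.mem_closedBall, dist_zero_right] at hx1
    have hk' : 4 * δ * (k : ℝ) ≤ 1 := by
      have : (k : ℝ) ≤ N := by exact_mod_cast (Finset.mem_range.mp hk).le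
      calc 4 * δ * (k : ℝ) ≤ 4 * δ * (1 / (4 * δ)) := by gcongr; linarith
        _ = 1 := by field_simp
    refine ⟨?_, ?_⟩
    · rw [Metric.mem_closedBall, dist_zero_right]
      have e : x = (x + (-(4 * δ * k)) • v) + (4 * δ * k) • v := by
        rw [neg_smul]; abel
      have hn : ‖(4 * δ * (k : ℝ)) • v‖ ≤ ‖v‖ := by
        rw [norm_smul, Real.norm_eq_abs, abs_of_nonneg (by positivity)]
        exact mul_le_of_le_one_left (norm_nonneg v) hk'
      rw [e]
      exact (norm_add_le _ _).trans (add_le_add hx1 hn)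
    · rw [hmap, hℓv, mul_zero, add_zero] at hx2
      exact hx2
  have hdisj : PairwiseDisjoint (↑(Finset.range N)) T := by
    intro k _ l _ hkl
    change Disjoint (T k) (T l)
    rw [disjoint_left]
    rintro x ⟨-, -, hk⟩ ⟨-, -, hl⟩
    rw [hmap, hmv, mul_one, abs_le] at hk hl
    rcases lt_or_gt_of_ne hkl with h | h
    · have : (k : ℝ) + 1 ≤ l := by exact_mod_cast h
      nlinarith [hk.2, hl.1]
    · have : (l : ℝ) + 1 ≤ k := by exact_mod_cast h
      nlinarith [hk.1, hl.2]
  have hsum : (N : ℝ≥0∞) * volume S ≤ volume S' := by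
    calc (N : ℝ≥0∞) * volume S = ∑ k ∈ Finset.range N, volume (T k) := by simp [hTv]
      _ = volume (⋃ k ∈ Finset.range N, T k) :=
          (measure_biUnion_finset hdisj fun k _ => hTm k).symm
      _ ≤ volume S' := measure_mono (iUnion₂_subset hTsub)
  have hreal : (N : ℝ) * volume.real S ≤ volume.real S' := by
    have := ENNReal.toReal_mono hS'fin hsum
    simpa [Measure.real] using this
  have h0 : 0 ≤ volume.real S := measureReal_nonneg
  calc volume.real S = 8 * δ * (1 / (8 * δ) * volume.real S) := by field_simp
    _ ≤ 8 * δ * ((N : ℝ) * volume.real S) := by gcongr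
    _ ≤ _ := by gcongr

theorem isThin_of_linear {ℓ m : Euc n →ᵃ[ℝ] ℝ} (hℓ : ℓ.linear ≠ 0) {v : Euc n}
    (hℓv : ℓ.linear v = 0) (hmv : m.linear v = 1) : IsThin {x | ℓ x = 0 ∧ m x = 0} := by
  intro R M ε hε
  have hℓc : Continuous ℓ := ℓ.continuous_of_finiteDimensional
  have hmc : Continuous m := m.continuous_of_finiteDimensional
  let θ : ContDiffBump (0 : ℝ) := ⟨1, 2, one_pos, one_lt_two⟩
  have hθs : ContDiff ℝ ∞ θ := θ.contDiff
  obtain ⟨Cθ, hCθ⟩ := (hθs.continuous_deriv (by simp)).bounded_above_of_compact_support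
    θ.hasCompactSupport.deriv
  have hCθ0 : 0 ≤ Cθ := (norm_nonneg _).trans (hCθ 0)
  have hθ1 : ∀ s, |θ s| ≤ 1 := fun s => by
    rw [abs_of_nonneg θ.nonneg]
    exact θ.le_one
  set Λ : ℝ := ∑ i, (|ℓ.linear (EuclideanSpace.single i 1)| +
    |m.linear (EuclideanSpace.single i 1)|) with hΛ
  have hΛi : ∀ i, |ℓ.linear (EuclideanSpace.single i 1)| +
      |m.linear (EuclideanSpace.single i 1)| ≤ Λ := fun i =>
    Finset.single_le_sum (f := fun i => |ℓ.linear (EuclideanSpace.single i 1)| +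
      |m.linear (EuclideanSpace.single i 1)|) (fun _ _ => by positivity) (Finset.mem_univ i)
  have hΛ0 : 0 ≤ Λ := Finset.sum_nonneg fun _ _ => by positivity
  set C : ℝ := (Cθ * Λ + 1) * |M| with hC
  have hC0 : 0 ≤ C := by positivity
  obtain ⟨δ₀, hδ₀, hslab⟩ := exists_volume_slab_le hℓ (R + ‖v‖) (ε := ε / (16 * C + 1))
    (by positivity)
  set δ : ℝ := min (1 / 16) (δ₀ / 2) with hδ
  have hδ0 : 0 < δ := by positivity
  have hδ1 : 2 * δ ≤ 1 / 8 := by linarith [min_le_left (1 / 16 : ℝ) (δ₀ / 2)]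
  have hδ2 : 2 * δ ≤ δ₀ := by linarith [min_le_right (1 / 16 : ℝ) (δ₀ / 2)]
  set χ₁ : Euc n → ℝ := fun x => θ (δ⁻¹ * ℓ x) with hχ₁
  set χ₂ : Euc n → ℝ := fun x => θ (δ⁻¹ * m x) with hχ₂
  have hχ₁s : ContDiff ℝ ∞ χ₁ := hθs.comp (contDiff_const.mul (contDiff_affine ℓ))
  have hχ₂s : ContDiff ℝ ∞ χ₂ := hθs.comp (contDiff_const.mul (contDiff_affine m))
  have hnear : ∀ (d : Euc n →ᵃ[ℝ] ℝ) (x : Euc n), d x = 0 → ∀ᶠ y in 𝓝 x, θ (δ⁻¹ * d y) = 1 := by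
    intro d x hx
    have hd : Continuous fun y => δ⁻¹ * d y :=
      continuous_const.mul d.continuous_of_finiteDimensional
    have : ∀ᶠ y in 𝓝 x, δ⁻¹ * d y ∈ Metric.closedBall (0 : ℝ) 1 := by
      refine hd.continuousAt.preimage_mem_nhds ?_
      rw [hx, mul_zero]
      exact Metric.closedBall_mem_nhds 0 one_pos
    filter_upwards [this] with y hy using θ.one_of_mem_closedBall hy
  have hfar : ∀ s : ℝ, θ (δ⁻¹ * s) ≠ 0 → |s| ≤ 2 * δ := by
    intro s hs
    by_contra! h
    apply hs
    apply θ.zero_of_le_dist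
    rw [dist_zero_right, norm_mul, Real.norm_eq_abs, Real.norm_eq_abs,
      abs_of_pos (inv_pos.mpr hδ0)]
    change 2 ≤ δ⁻¹ * |s|
    rw [le_inv_mul_iff₀ hδ0]
    linarith
  refine ⟨fun x => χ₁ x * χ₂ x, hχ₁s.mul hχ₂s, fun x => ⟨mul_nonneg θ.nonneg θ.nonneg,
    mul_le_one₀ θ.le_one θ.nonneg θ.le_one⟩, fun x hx => ?_, fun φ hφ hR h1 h2 i => ?_⟩
  · filter_upwards [hnear ℓ x hx.1, hnear m x hx.2] with y e1 e2
    simp only [hχ₁, hχ₂, e1, e2, mul_one]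
  set S := Metric.closedBall (0 : Euc n) R ∩ {x | |ℓ x| ≤ 2 * δ ∧ |m x| ≤ 2 * δ} with hS
  have hSc : IsClosed S := Metric.isClosed_closedBall.inter
    ((isClosed_le hℓc.abs continuous_const).inter (isClosed_le hmc.abs continuous_const))
  have hsupp : tsupport (fun x => χ₁ x * χ₂ x * φ x) ⊆ S := by
    refine closure_minimal (fun x hx => ?_) hSc
    rw [Function.mem_support] at hx
    refine ⟨hR (subset_tsupport _ (right_ne_zero_of_mul hx)), ?_, ?_⟩
    · exact hfar _ (left_ne_zero_of_mul (left_ne_zero_of_mul hx))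
    · exact hfar _ (right_ne_zero_of_mul (left_ne_zero_of_mul hx))
  have hM : 0 ≤ |M| := abs_nonneg M
  have hbound : ∀ x, |pderiv i (fun x => χ₁ x * χ₂ x * φ x) x| ≤ C / δ := by
    intro x
    rw [pderiv_mul (hχ₁s.mul hχ₂s) hφ, pderiv_mul hχ₁s hχ₂s, hχ₁, hχ₂,
      pderiv_comp_affine (hθs.differentiable (by simp)),
      pderiv_comp_affine (hθs.differentiable (by simp))]
    have b0 : ∀ (d : Euc n →ᵃ[ℝ] ℝ), |deriv θ (δ⁻¹ * d x) *
        (δ⁻¹ * d.linear (EuclideanSpace.single i 1))| ≤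
        Cθ * (δ⁻¹ * |d.linear (EuclideanSpace.single i 1)|) := fun d => by
      rw [abs_mul, abs_mul, abs_of_pos (inv_pos.mpr hδ0)]
      gcongr
      exact hCθ _
    have hφM : |φ x| ≤ |M| := (h1 x).trans (le_abs_self M)
    have hφM' : |pderiv i φ x| ≤ |M| := (h2 i x).trans (le_abs_self M)
    have c1 : |θ (δ⁻¹ * ℓ x) * θ (δ⁻¹ * m x) * pderiv i φ x| ≤ |M| := by
      rw [abs_mul, abs_mul]
      calc _ ≤ 1 * 1 * |M| := by gcongr <;> exact hθ1 _
        _ = _ := by ring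
    have c2 : |φ x * (θ (δ⁻¹ * ℓ x) * (deriv θ (δ⁻¹ * m x) *
        (δ⁻¹ * m.linear (EuclideanSpace.single i 1))) + θ (δ⁻¹ * m x) * (deriv θ (δ⁻¹ * ℓ x) *
        (δ⁻¹ * ℓ.linear (EuclideanSpace.single i 1))))| ≤ |M| * (Cθ * (δ⁻¹ * Λ)) := by
      rw [abs_mul]
      gcongr
      refine (abs_add_le _ _).trans ?_
      rw [abs_mul, abs_mul (θ (δ⁻¹ * m x))]
      calc _ ≤ 1 * (Cθ * (δ⁻¹ * |m.linear (EuclideanSpace.single i 1)|)) +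
            1 * (Cθ * (δ⁻¹ * |ℓ.linear (EuclideanSpace.single i 1)|)) := by
            gcongr
            · exact hθ1 _
            · exact b0 m
            · exact hθ1 _
            · exact b0 ℓ
        _ = Cθ * (δ⁻¹ * (|ℓ.linear (EuclideanSpace.single i 1)| +
            |m.linear (EuclideanSpace.single i 1)|)) := by ring
        _ ≤ _ := by gcongr; exact hΛi i
    refine (abs_add_le _ _).trans ((add_le_add c1 c2).trans ?_)
    rw [hC, le_div_iff₀ hδ0]
    have e : (|M| + |M| * (Cθ * (δ⁻¹ * Λ))) * δ = |M| * δ + |M| * (Cθ * Λ) := by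
      field_simp
    rw [e]
    nlinarith [mul_le_mul_of_nonneg_left (show δ ≤ 1 by linarith) hM]
  have hSfin : volume S < ⊤ := (measure_mono inter_subset_left).trans_lt measure_closedBall_lt_top
  rw [← setIntegral_eq_integral_of_forall_compl_eq_zero (s := S) fun x hx => by
    rw [pderiv_eq_zero_of_notMem_tsupport fun h => hx (hsupp h), abs_zero]]
  refine (Real.le_norm_self _).trans ((norm_setIntegral_le_of_norm_le_const (C := C / δ) hSfin
    fun x _ => ?_).trans ?_)
  · rw [Real.norm_eq_abs, abs_abs]
    exact hbound x
  calc C / δ * volume.real S ≤ C / δ * (8 * (2 * δ) * (ε / (16 * C + 1))) := by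
        gcongr
        refine (volume_inter_slab_le hℓv hmv R (by positivity) hδ1).trans ?_
        gcongr
        exact hslab _ (by positivity) hδ2
    _ = 16 * C * ε / (16 * C + 1) := by
        field_simp
        ring
    _ ≤ ε := by
        rw [div_le_iff₀ (by positivity)]
        nlinarith

/-- An affine functional vanishing at a common zero and along the kernel of another one is a
multiple of the latter. -/
theorem exists_eq_mul_of_ker_le {ℓ m : Euc n →ᵃ[ℝ] ℝ} (hℓ : ℓ.linear ≠ 0) {x₀ : Euc n}
    (h0 : ℓ x₀ = 0) (hm0 : m x₀ = 0) (h : ∀ w, ℓ.linear w = 0 → m.linear w = 0) :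
    ∃ c, ∀ x, m x = c * ℓ x := by
  obtain ⟨u, hu⟩ : ∃ u, ℓ.linear u ≠ 0 := by
    by_contra! h'
    exact hℓ (LinearMap.ext h')
  refine ⟨m.linear u / ℓ.linear u, fun x => ?_⟩
  have e1 : ℓ x = ℓ.linear (x - x₀) := by
    have := ℓ.linearMap_vsub x x₀
    simp only [vsub_eq_sub, h0, sub_zero] at this
    exact this.symm
  have e2 : m x = m.linear (x - x₀) := by
    have := m.linearMap_vsub x x₀
    simp only [vsub_eq_sub, hm0, sub_zero] at this
    exact this.symm
  have := h ((x - x₀) - (ℓ.linear (x - x₀) / ℓ.linear u) • u) (by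
    rw [map_sub, map_smul, smul_eq_mul]
    field_simp
    ring)
  rw [map_sub, map_smul, smul_eq_mul, sub_eq_zero] at this
  rw [e1, e2, this]
  ring

theorem isThin_inter {ℓ m : Euc n →ᵃ[ℝ] ℝ} (hℓ : ℓ.linear ≠ 0) (hm : m.linear ≠ 0)
    (hne : {x | ℓ x = 0} ≠ {x | m x = 0}) : IsThin {x | ℓ x = 0 ∧ m x = 0} := by
  by_cases h : ∃ w, ℓ.linear w = 0 ∧ m.linear w ≠ 0
  · obtain ⟨w, h1, h2⟩ := h
    refine isThin_of_linear hℓ (v := (m.linear w)⁻¹ • w) ?_ ?_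
    · rw [map_smul, h1, smul_zero]
    · rw [map_smul, smul_eq_mul, inv_mul_cancel₀ h2]
  · push Not at h
    suffices {x | ℓ x = 0 ∧ m x = 0} = ∅ by
      rw [this]
      exact isThin_empty
    refine eq_empty_of_forall_notMem fun x₀ hx₀ => hne ?_
    obtain ⟨c, hc⟩ := exists_eq_mul_of_ker_le hℓ hx₀.1 hx₀.2 h
    have hc0 : c ≠ 0 := by
      rintro rfl
      apply hm
      ext v
      have := m.map_vadd 0 v
      simp only [hc, zero_mul] at this
      simpa using this.symm
    ext x
    simp [hc, hc0]

end Codimension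

section Kink

variable {n : ℕ}

theorem exists_lipschitzWith_affine (a : Euc n →ᵃ[ℝ] ℝ) : ∃ C, LipschitzWith C a := by
  refine ⟨‖LinearMap.toContinuousLinearMap a.linear‖₊, ?_⟩
  have : (a : Euc n → ℝ) = fun x => LinearMap.toContinuousLinearMap a.linear x + a 0 := by
    funext x
    simpa using congrFun a.decomp x
  rw [this]
  simpa using (LinearMap.toContinuousLinearMap a.linear).lipschitz.add (LipschitzWith.const (a 0))

theorem exists_lipschitzWith_kink (b ℓ : Euc n →ᵃ[ℝ] ℝ) (c : ℝ) :
    ∃ C, LipschitzWith C fun x => b x + c * max (ℓ x) 0 := by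
  obtain ⟨C₁, h₁⟩ := exists_lipschitzWith_affine b
  obtain ⟨C₂, h₂⟩ := exists_lipschitzWith_affine ℓ
  exact ⟨_, h₁.add ((lipschitzWith_smul c).comp (h₂.max_const 0))⟩

/-- A function of finite Hessian variation on a convex open set, affine off a hyperplane, is the
sum of an affine function and a multiple of a one-sided linear function. -/
theorem exists_kink {f : Euc n → ℝ} (hf : Integrable f) {U : Set (Euc n)} (hU : IsOpen U)
    (hUc : Convex ℝ U) (hfin : variation f U ≠ ⊤) {ℓ : Euc n →ᵃ[ℝ] ℝ} (hℓ : ℓ.linear ≠ 0)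
    (h0 : variation f (U ∩ {x | ℓ x ≠ 0}) = 0) :
    ∃ (b : Euc n →ᵃ[ℝ] ℝ) (c : ℝ), ∀ᵐ x, x ∈ U → f x = b x + c * max (ℓ x) 0 := by
  have hℓc : Continuous ℓ := ℓ.continuous_of_finiteDimensional
  by_cases hz : ∃ x₀ ∈ U, ℓ x₀ = 0
  · obtain ⟨x₀, hx₀, hℓ0⟩ := hz
    have hpos : variation f (U ∩ ℓ ⁻¹' Ioi 0) = 0 := le_antisymm
      ((variation_mono f (fun x hx => ⟨hx.1, ne_of_gt hx.2⟩ : _ ⊆ U ∩ {x | ℓ x ≠ 0})).trans h0.le)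
      zero_le
    have hneg : variation f (U ∩ ℓ ⁻¹' Iio 0) = 0 := le_antisymm
      ((variation_mono f (fun x hx => ⟨hx.1, ne_of_lt hx.2⟩ : _ ⊆ U ∩ {x | ℓ x ≠ 0})).trans h0.le)
      zero_le
    obtain ⟨a, ha⟩ := exists_affine_of_variation_eq_zero hf (hU.inter (isOpen_Ioi.preimage hℓc))
      (hUc.inter ((convex_Ioi 0).affine_preimage ℓ)) hpos
    obtain ⟨b, hb⟩ := exists_affine_of_variation_eq_zero hf (hU.inter (isOpen_Iio.preimage hℓc))
      (hUc.inter ((convex_Iio 0).affine_preimage ℓ)) hneg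
    have hab : ∀ x ∈ U, ℓ x = 0 → a x = b x := fun x hx hx0 =>
      affine_eq_of_variation_ne_top hf hU hfin hℓ
        (by filter_upwards [ha] with y hy h1 h2 using hy ⟨h1, h2⟩)
        (by filter_upwards [hb] with y hy h1 h2 using hy ⟨h1, h2⟩) hx hx0
    obtain ⟨c, hc⟩ := exists_eq_mul_of_ker_le (m := a - b) hℓ hℓ0 (by
      simp [hab x₀ hx₀ hℓ0]) (fun w hw => by
      have hcont : Continuous fun s : ℝ => x₀ + s • w := by fun_prop
      have hev : ∀ᶠ s in 𝓝 (0 : ℝ), x₀ + s • w ∈ U :=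
        hcont.continuousAt.preimage_mem_nhds (by simpa using hU.mem_nhds hx₀)
      obtain ⟨s, hs, hs0⟩ :=
        ((hev.filter_mono nhdsWithin_le_nhds).and self_mem_nhdsWithin :
          ∀ᶠ s in 𝓝[≠] (0 : ℝ), _ ∧ s ∈ ({0}ᶜ : Set ℝ)).exists
      have e : ∀ d : Euc n →ᵃ[ℝ] ℝ, d (x₀ + s • w) = s * d.linear w + d x₀ := fun d => by
        have := d.map_vadd x₀ (s • w)
        rw [vadd_eq_add, add_comm] at this
        rw [this, map_smul, smul_eq_mul, vadd_eq_add]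
      have h1 := hab _ hs (by rw [e, hw, hℓ0]; simp)
      rw [e, e, hab x₀ hx₀ hℓ0] at h1
      have h2 : s * (a.linear w - b.linear w) = 0 := by linarith
      simpa using (mul_eq_zero.mp h2).resolve_left hs0)
    refine ⟨b, c, ?_⟩
    filter_upwards [ha, hb, ae_affine_ne_zero hℓ] with x h1 h2 h3 hx
    rcases lt_or_gt_of_ne h3 with h | h
    · rw [h2 ⟨hx, h⟩, max_eq_right h.le]
      simp
    · rw [h1 ⟨hx, h⟩, max_eq_left (le_of_lt h), ← hc x]
      simp
  · push Not at hz
    have : U ∩ {x | ℓ x ≠ 0} = U := inter_eq_left.mpr hz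
    rw [this] at h0
    obtain ⟨b, hb⟩ := exists_affine_of_variation_eq_zero hf hU hUc h0
    refine ⟨b, 0, ?_⟩
    filter_upwards [hb] with x hx hxU
    rw [hx hxU]
    simp

end Kink

section Arrangement

variable {n : ℕ} {ι : Type*} {O : Set (Euc n)} {ℓ : ι → Euc n →ᵃ[ℝ] ℝ}

/-- The sign encoded by a Boolean. -/
def boolSign (b : Bool) : ℝ := if b then 1 else -1

/-- The open cells of a hyperplane arrangement in `O`. -/
def cell (O : Set (Euc n)) (ℓ : ι → Euc n →ᵃ[ℝ] ℝ) (σ : ι → Bool) : Set (Euc n) :=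
  O ∩ ⋂ j, {x | 0 < boolSign (σ j) * ℓ j x}

/-- Neighbourhoods of the relatively open facets of a hyperplane arrangement in `O`. -/
def facetNhd (O : Set (Euc n)) (ℓ : ι → Euc n →ᵃ[ℝ] ℝ) (k : ι × (ι → Bool)) : Set (Euc n) :=
  O ∩ ⋂ j, {x | k.2 k.1 = true ∧ (j ≠ k.1 → |ℓ k.1 x| < boolSign (k.2 j) * ℓ j x)}

theorem convex_setOf_pos_affine (a : Euc n →ᵃ[ℝ] ℝ) : Convex ℝ {x | 0 < a x} :=
  (convex_Ioi 0).affine_preimage a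

theorem convex_cell (hO : Convex ℝ O) (σ : ι → Bool) : Convex ℝ (cell O ℓ σ) := by
  refine hO.inter (convex_iInter fun j => ?_)
  simpa using convex_setOf_pos_affine (boolSign (σ j) • ℓ j)

theorem isOpen_cell [Finite ι] (hO : IsOpen O) (σ : ι → Bool) : IsOpen (cell O ℓ σ) :=
  hO.inter (isOpen_iInter_of_finite fun j => isOpen_lt continuous_const
    (continuous_const.mul (ℓ j).continuous_of_finiteDimensional))

theorem convex_facetNhd (hO : Convex ℝ O) (k : ι × (ι → Bool)) : Convex ℝ (facetNhd O ℓ k) := by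
  refine hO.inter (convex_iInter fun j => ?_)
  by_cases hk : k.2 k.1 = true
  · by_cases hj : j = k.1
    · simpa [hk, hj] using convex_univ
    · have h1 := convex_setOf_pos_affine (boolSign (k.2 j) • ℓ j - ℓ k.1)
      have h2 := convex_setOf_pos_affine (boolSign (k.2 j) • ℓ j + ℓ k.1)
      convert! h1.inter h2 using 1
      ext x
      simp only [hk, hj, mem_ofPred_eq, abs_lt, mem_inter_iff, true_and, ne_eq,
        not_false_eq_true, forall_const, AffineMap.coe_sub, AffineMap.coe_add, AffineMap.coe_smul,
        Pi.sub_apply, Pi.add_apply, Pi.smul_apply, smul_eq_mul]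
      constructor <;> rintro ⟨h, h'⟩ <;> constructor <;> linarith
  · simpa [hk] using convex_empty

theorem isOpen_facetNhd [Finite ι] (hO : IsOpen O) (k : ι × (ι → Bool)) :
    IsOpen (facetNhd O ℓ k) := by
  refine hO.inter (isOpen_iInter_of_finite fun j => ?_)
  by_cases hk : k.2 k.1 = true
  · by_cases hj : j = k.1
    · simp [hk, hj]
    · simpa [hk, hj] using isOpen_lt (ℓ k.1).continuous_of_finiteDimensional.abs
        (continuous_const.mul (ℓ j).continuous_of_finiteDimensional)
  · simp [hk]

theorem eq_of_boolSign_mul_pos {b b' : Bool} {t : ℝ} (h : 0 < boolSign b * t)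
    (h' : 0 < boolSign b' * t) : b = b' := by
  cases b <;> cases b' <;> simp [boolSign] at h h' ⊢ <;> linarith

theorem abs_boolSign_mul (b : Bool) (t : ℝ) : |boolSign b * t| = |t| := by
  cases b <;> simp [boolSign]

theorem exists_boolSign_mul_pos {t : ℝ} (h : t ≠ 0) : ∃ b, 0 < boolSign b * t := by
  rcases lt_or_gt_of_ne h with h | h
  · exact ⟨false, by simpa [boolSign] using h⟩
  · exact ⟨true, by simpa [boolSign] using h⟩

theorem pairwise_disjoint_facetNhd :
    Pairwise fun k l : ι × (ι → Bool) => Disjoint (facetNhd O ℓ k) (facetNhd O ℓ l) := by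
  rintro ⟨i, σ⟩ ⟨j, τ⟩ hne
  rw [disjoint_left]
  rintro x ⟨-, h⟩ ⟨-, h'⟩
  simp only [mem_iInter, mem_ofPred_eq] at h h'
  apply hne
  by_cases hij : i = j
  · subst hij
    refine Prod.ext rfl (funext fun k => ?_)
    by_cases hk : k = i
    · subst hk
      exact (h k).1.trans (h' k).1.symm
    · exact eq_of_boolSign_mul_pos ((abs_nonneg _).trans_lt ((h k).2 hk))
        ((abs_nonneg _).trans_lt ((h' k).2 hk))
  · have h1 := (h j).2 (Ne.symm hij)
    have h2 := (h' i).2 hij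
    have h3 := le_abs_self (boolSign (σ j) * ℓ j x)
    have h4 := le_abs_self (boolSign (τ i) * ℓ i x)
    rw [abs_boolSign_mul] at h3 h4
    linarith

theorem mem_cell_of_ne_zero {x : Euc n} (hx : x ∈ O) (h : ∀ j, ℓ j x ≠ 0) :
    ∃ σ, x ∈ cell O ℓ σ := by
  choose σ hσ using fun j => exists_boolSign_mul_pos (h j)
  exact ⟨σ, hx, mem_iInter.mpr hσ⟩

theorem mem_facetNhd_of_eq_zero [DecidableEq ι] {x : Euc n} (hx : x ∈ O) {i : ι}
    (hi : ℓ i x = 0) (h : ∀ j, j ≠ i → ℓ j x ≠ 0) : ∃ σ, x ∈ facetNhd O ℓ (i, σ) := by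
  have : ∀ j, ∃ b, (j = i → b = true) ∧ (j ≠ i → 0 < boolSign b * ℓ j x) := fun j => by
    by_cases hj : j = i
    · exact ⟨true, fun _ => rfl, fun h => absurd hj h⟩
    · obtain ⟨b, hb⟩ := exists_boolSign_mul_pos (h j hj)
      exact ⟨b, fun h => absurd h hj, fun _ => hb⟩
  choose σ hσ using this
  refine ⟨σ, hx, mem_iInter.mpr fun j => ⟨(hσ i).1 rfl, fun hj => ?_⟩⟩
  change |ℓ i x| < _
  rw [hi, abs_zero]
  exact (hσ j).2 hj

/-- The complement in `O` of the hyperplanes. -/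
def offHyperplanes (O : Set (Euc n)) (ℓ : ι → Euc n →ᵃ[ℝ] ℝ) : Set (Euc n) :=
  O ∩ ⋂ j, {x | ℓ j x ≠ 0}

theorem isOpen_offHyperplanes [Finite ι] (hO : IsOpen O) : IsOpen (offHyperplanes O ℓ) :=
  hO.inter (isOpen_iInter_of_finite fun j =>
    isOpen_ne_fun (ℓ j).continuous_of_finiteDimensional continuous_const)

theorem cell_subset_offHyperplanes (σ : ι → Bool) : cell O ℓ σ ⊆ offHyperplanes O ℓ := by
  rintro x ⟨hx, h⟩
  refine ⟨hx, mem_iInter.mpr fun j h0 => ?_⟩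
  have := mem_iInter.mp h j
  simp [h0] at this

theorem facetNhd_inter_subset_offHyperplanes (k : ι × (ι → Bool)) :
    facetNhd O ℓ k ∩ {x | ℓ k.1 x ≠ 0} ⊆ offHyperplanes O ℓ := by
  rintro x ⟨⟨hx, h⟩, hk⟩
  refine ⟨hx, mem_iInter.mpr fun j h0 => ?_⟩
  by_cases hj : j = k.1
  · subst hj
    exact hk h0
  · have := (mem_iInter.mp h j).2 hj
    rw [h0, mul_zero] at this
    exact (abs_nonneg _).not_gt this

theorem diff_subset_cover [Fintype ι] [DecidableEq ι] :
    O \ (⋃ p ∈ (Finset.univ : Finset ι).offDiag, {x | ℓ p.1 x = 0 ∧ ℓ p.2 x = 0}) ⊆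
      (⋃ k ∈ (Finset.univ : Finset (ι × (ι → Bool))), facetNhd O ℓ k) ∪ offHyperplanes O ℓ := by
  rintro x ⟨hx, hxZ⟩
  by_cases h : ∃ i, ℓ i x = 0
  · obtain ⟨i, hi⟩ := h
    obtain ⟨σ, hσ⟩ := mem_facetNhd_of_eq_zero hx hi fun j hj h0 => hxZ (by
      simp only [mem_iUnion]
      exact ⟨(j, i), by simpa using hj, h0, hi⟩)
    left
    simp only [mem_iUnion]
    exact ⟨(i, σ), Finset.mem_univ _, hσ⟩
  · push Not at h
    exact Or.inr ⟨hx, mem_iInter.mpr h⟩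

theorem exists_kink_facetNhd [Finite ι] {f : Euc n → ℝ} (hO : IsOpen O) (hOc : Convex ℝ O) (hℓ : ∀ i, (ℓ i).linear ≠ 0)
    (hf : Integrable f) (hfin : variation f O ≠ ⊤) (h0 : variation f (offHyperplanes O ℓ) = 0)
    (k : ι × (ι → Bool)) : ∃ (b : Euc n →ᵃ[ℝ] ℝ) (c : ℝ),
      ∀ᵐ x, x ∈ facetNhd O ℓ k → f x = b x + c * max (ℓ k.1 x) 0 := by
  refine exists_kink hf (isOpen_facetNhd hO k) (convex_facetNhd hOc k)
    (ne_top_of_le_ne_top hfin (variation_mono f inter_subset_left)) (hℓ k.1) ?_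
  exact le_antisymm ((variation_mono f (facetNhd_inter_subset_offHyperplanes k)).trans h0.le)
    zero_le

theorem exists_variation_sub_smul_eq_zero [Finite ι] {f g : Euc n → ℝ} (hO : IsOpen O) (hOc : Convex ℝ O)
    (hℓ : ∀ i, (ℓ i).linear ≠ 0) (hf : Integrable f) (hg : Integrable g)
    (hfin : variation f O ≠ ⊤) (hgin : variation g O ≠ ⊤)
    (hf0 : variation f (offHyperplanes O ℓ) = 0) (hg0 : variation g (offHyperplanes O ℓ) = 0)
    (hfg : ∀ V, IsOpen V → V ⊆ O → variation g V = 0 → variation f V = 0)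
    (k : ι × (ι → Bool)) : ∃ ρ : ℝ, variation (f + (-ρ) • g) (facetNhd O ℓ k) = 0 := by
  obtain ⟨b, c, hbc⟩ := exists_kink_facetNhd hO hOc hℓ hf hfin hf0 k
  obtain ⟨b', c', hbc'⟩ := exists_kink_facetNhd hO hOc hℓ hg hgin hg0 k
  have hm := (isOpen_facetNhd (ℓ := ℓ) hO k).measurableSet
  by_cases hc : c' = 0
  · refine ⟨0, ?_⟩
    have : variation g (facetNhd O ℓ k) = 0 := by
      refine variation_eq_zero_of_ae_eq_affine hm b' ?_
      filter_upwards [hbc'] with x hx hxk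
      rw [hx hxk, hc]
      simp
    simpa using hfg _ (isOpen_facetNhd hO k) inter_subset_left this
  · refine ⟨c / c', variation_eq_zero_of_ae_eq_affine hm (b - (c / c') • b') ?_⟩
    filter_upwards [hbc, hbc'] with x h1 h2 hx
    simp only [Pi.add_apply, Pi.smul_apply, h1 hx, h2 hx, smul_eq_mul, AffineMap.coe_sub,
      AffineMap.coe_smul, Pi.sub_apply]
    field_simp
    ring

variable [Fintype ι] [DecidableEq ι] {f g : Euc n → ℝ}

theorem variation_le_sum_facetNhd (hO : IsOpen O) (hℓ : ∀ i, (ℓ i).linear ≠ 0)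
    (hd : ∀ i j, i ≠ j → {x | ℓ i x = 0} ≠ {x | ℓ j x = 0}) (hf : Integrable f) {K : ℝ}
    (hK : 0 ≤ K) (hb : DerivBound f K O) (h0 : variation f (offHyperplanes O ℓ) = 0) :
    variation f O ≤ ∑ k, variation f (facetNhd O ℓ k) := by
  refine (variation_le_variation_diff_biUnion hf (Finset.univ : Finset ι).offDiag
    (Z := fun p => {x | ℓ p.1 x = 0 ∧ ℓ p.2 x = 0}) (fun p hp => ?_) hK hb).trans ?_
  · exact isThin_inter (hℓ _) (hℓ _) (hd _ _ (Finset.mem_offDiag.mp hp).2.2)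
  refine (variation_mono f diff_subset_cover).trans ?_
  refine (variation_union_le hf (isOpen_biUnion fun k _ => isOpen_facetNhd hO k)
    (isOpen_offHyperplanes hO)).trans ?_
  rw [h0, add_zero]
  exact variation_biUnion_le hf _ fun k => isOpen_facetNhd hO k

theorem exists_derivBound (hO : IsOpen O) (hOc : Convex ℝ O) (hOb : Bornology.IsBounded O)
    (hℓ : ∀ i, (ℓ i).linear ≠ 0) (hd : ∀ i j, i ≠ j → {x | ℓ i x = 0} ≠ {x | ℓ j x = 0})
    (hf : Integrable f) (hfO : ∀ x, x ∉ O → f x = 0) (hfin : variation f O ≠ ⊤)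
    (h0 : variation f (offHyperplanes O ℓ) = 0) : ∃ K, 0 ≤ K ∧ DerivBound f K O := by
  have hcell : ∀ σ, ∃ a : Euc n →ᵃ[ℝ] ℝ, ∀ᵐ x, x ∈ cell O ℓ σ → f x = a x := fun σ =>
    exists_affine_of_variation_eq_zero hf (isOpen_cell hO σ) (convex_cell hOc σ)
      (le_antisymm ((variation_mono f (cell_subset_offHyperplanes σ)).trans h0.le) zero_le)
  choose a ha using hcell
  choose b c hbc using exists_kink_facetNhd hO hOc hℓ hf hfin h0
  choose C hC using fun k : ι × (ι → Bool) => exists_lipschitzWith_kink (b k) (ℓ k.1) (c k)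
  choose D hD using fun σ => exists_lipschitzWith_affine (a σ)
  set K : ℝ := (∑ k, (C k : ℝ)) + ∑ σ, (D σ : ℝ) with hK
  have hC0 : 0 ≤ ∑ k, (C k : ℝ) := Finset.sum_nonneg fun k _ => (C k).coe_nonneg
  have hD0 : 0 ≤ ∑ σ, (D σ : ℝ) := Finset.sum_nonneg fun σ _ => (D σ).coe_nonneg
  have hCK : ∀ k, (C k : ℝ) ≤ K := fun k => by
    have := Finset.single_le_sum (f := fun k => (C k : ℝ)) (fun k _ => (C k).coe_nonneg)
      (Finset.mem_univ k)
    linarith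
  have hDK : ∀ σ, (D σ : ℝ) ≤ K := fun σ => by
    have := Finset.single_le_sum (f := fun σ => (D σ : ℝ)) (fun σ _ => (D σ).coe_nonneg)
      (Finset.mem_univ σ)
    linarith
  have hbdd : ∀ σ, ∃ M, ∀ x ∈ O, |a σ x| ≤ M := fun σ => by
    obtain ⟨M, hM⟩ := isBounded_iff_forall_norm_le.mp ((hD σ).isBounded_image hOb)
    exact ⟨M, fun x hx => hM _ (mem_image_of_mem _ hx)⟩
  choose M hM using hbdd
  have hae : ∀ᵐ x, |f x| ≤ ∑ σ, |M σ| := by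
    have hne : ∀ᵐ x, ∀ i, ℓ i x ≠ 0 := ae_all_iff.mpr fun i => ae_affine_ne_zero (hℓ i)
    filter_upwards [hne, ae_all_iff.mpr ha] with x hx hax
    by_cases hxO : x ∈ O
    · obtain ⟨σ, hσ⟩ := mem_cell_of_ne_zero hxO hx
      rw [hax σ hσ]
      exact (hM σ x hxO).trans ((le_abs_self _).trans (Finset.single_le_sum
        (f := fun σ => |M σ|) (fun σ _ => abs_nonneg _) (Finset.mem_univ σ)))
    · rw [hfO x hxO, abs_zero]
      positivity
  refine ⟨K, by positivity, ?_⟩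
  refine DerivBound.of_diff_biUnion hf (by positivity) hae (Finset.univ : Finset ι).offDiag
    (Z := fun p => {x | ℓ p.1 x = 0 ∧ ℓ p.2 x = 0})
    (fun p hp => isThin_inter (hℓ _) (hℓ _) (hd _ _ (Finset.mem_offDiag.mp hp).2.2)) ?_
  refine DerivBound.mono ?_ diff_subset_cover
  refine DerivBound.union hf (isOpen_biUnion fun k _ => isOpen_facetNhd hO k)
    (isOpen_offHyperplanes hO) ?_ ?_
  · exact DerivBound.biUnion hf _ (fun k => isOpen_facetNhd hO k) fun k =>
      (derivBound_of_lipschitzWith (hC k) (hbc k)).of_le (hCK k)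
  · refine DerivBound.mono (B := ⋃ σ ∈ (Finset.univ : Finset (ι → Bool)), cell O ℓ σ) ?_ ?_
    · exact DerivBound.biUnion hf _ (fun σ => isOpen_cell hO σ) fun σ =>
        (derivBound_of_lipschitzWith (hD σ) (ha σ)).of_le (hDK σ)
    · rintro x ⟨hx, hne⟩
      obtain ⟨σ, hσ⟩ := mem_cell_of_ne_zero hx (mem_iInter.mp hne)
      simp only [mem_iUnion]
      exact ⟨σ, Finset.mem_univ σ, hσ⟩

theorem variation_add_smul_eq_zero (hf : Integrable f) (hg : Integrable g) {V : Set (Euc n)}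
    (hf0 : variation f V = 0) (hg0 : variation g V = 0) (c : ℝ) : variation (g + c • f) V = 0 := by
  refine le_antisymm ((variation_add_le hg (hf.smul c) V).trans ?_) zero_le
  rw [hg0, zero_add]
  refine (variation_smul_le c f V).trans ?_
  rw [hf0, mul_zero]

/-- If `f` is affine wherever `g` is, then a small multiple of `f` perturbs the variation of `g`
linearly. -/
theorem exists_variation_add_smul_le (hO : IsOpen O) (hOc : Convex ℝ O)
    (hOb : Bornology.IsBounded O) (hℓ : ∀ i, (ℓ i).linear ≠ 0)
    (hd : ∀ i j, i ≠ j → {x | ℓ i x = 0} ≠ {x | ℓ j x = 0}) (hf : Integrable f)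
    (hg : Integrable g) (hfO : ∀ x, x ∉ O → f x = 0) (hgO : ∀ x, x ∉ O → g x = 0)
    (hfin : variation f O ≠ ⊤) (hgin : variation g O ≠ ⊤)
    (hg0 : variation g (offHyperplanes O ℓ) = 0)
    (hfg : ∀ V, IsOpen V → V ⊆ O → variation g V = 0 → variation f V = 0) :
    ∃ ε : ℝ, 0 < ε ∧ ε ≤ 1 / 2 ∧
      variation (g + ε • f) O + variation (g + (-ε) • f) O ≤ 2 * variation g O := by
  have hf0 : variation f (offHyperplanes O ℓ) = 0 :=
    hfg _ (isOpen_offHyperplanes hO) inter_subset_left hg0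
  choose ρ hρ using exists_variation_sub_smul_eq_zero hO hOc hℓ hf hg hfin hgin hf0 hg0 hfg
  obtain ⟨Kf, hKf, hbf⟩ := exists_derivBound hO hOc hOb hℓ hd hf hfO hfin hf0
  obtain ⟨Kg, hKg, hbg⟩ := exists_derivBound hO hOc hOb hℓ hd hg hgO hgin hg0
  set S : ℝ := ∑ k, |ρ k| with hS
  have hS0 : 0 ≤ S := Finset.sum_nonneg fun k _ => abs_nonneg _
  set ε : ℝ := 1 / (2 + S) with hε
  have hε0 : 0 < ε := by positivity
  have hε1 : ∀ k, |ε * ρ k| ≤ 1 := fun k => by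
    have : |ρ k| ≤ S := Finset.single_le_sum (f := fun k => |ρ k|) (fun k _ => abs_nonneg _)
      (Finset.mem_univ k)
    rw [abs_mul, abs_of_pos hε0, hε, one_div, inv_mul_le_iff₀ (by positivity)]
    linarith
  have hglob : ∀ c : ℝ, variation (g + c • f) O ≤
      ∑ k, variation (g + c • f) (facetNhd O ℓ k) := fun c =>
    variation_le_sum_facetNhd hO hℓ hd (hg.add (hf.smul c)) (by positivity)
      (hbg.add hg (hf.smul c) (hbf.const_smul c)) (variation_add_smul_eq_zero hf hg hf0 hg0 c)
  have hloc : ∀ (c : ℝ) k, variation (g + c • f) (facetNhd O ℓ k) ≤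
      ENNReal.ofReal |1 + c * ρ k| * variation g (facetNhd O ℓ k) := fun c k => by
    have e : g + c • f = (1 + c * ρ k) • g + c • (f + (-ρ k) • g) := by
      funext x
      simp
      ring
    rw [e]
    refine (variation_add_le (hg.smul _) ((hf.add (hg.smul _)).smul _) _).trans ?_
    have h2 := variation_smul_le c (f + (-ρ k) • g) (facetNhd O ℓ k)
    rw [hρ k, mul_zero] at h2
    calc _ ≤ ENNReal.ofReal |1 + c * ρ k| * variation g (facetNhd O ℓ k) + 0 :=
          add_le_add (variation_smul_le _ _ _) h2
      _ = _ := add_zero _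
  refine ⟨ε, hε0, ?_, ?_⟩
  · rw [hε, div_le_div_iff₀ (by positivity) (by norm_num)]
    linarith
  calc _ ≤ (∑ k, variation (g + ε • f) (facetNhd O ℓ k)) +
        ∑ k, variation (g + (-ε) • f) (facetNhd O ℓ k) := add_le_add (hglob _) (hglob _)
    _ = ∑ k, (variation (g + ε • f) (facetNhd O ℓ k) +
        variation (g + (-ε) • f) (facetNhd O ℓ k)) := Finset.sum_add_distrib.symm
    _ ≤ ∑ k, 2 * variation g (facetNhd O ℓ k) := by
        refine Finset.sum_le_sum fun k _ => (add_le_add (hloc ε k) (hloc (-ε) k)).trans ?_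
        have h := abs_le.mp (hε1 k)
        rw [← add_mul, ← ENNReal.ofReal_add (abs_nonneg _) (abs_nonneg _),
          abs_of_nonneg (by linarith), abs_of_nonneg (by linarith)]
        have : 1 + ε * ρ k + (1 + -ε * ρ k) = 2 := by ring
        rw [this]
        simp
    _ = 2 * ∑ k, variation g (facetNhd O ℓ k) := Finset.mul_sum _ _ _ |>.symm
    _ ≤ 2 * variation g O := by
        gcongr
        exact (sum_variation_le hg _ pairwise_disjoint_facetNhd).trans
          (variation_mono g (iUnion₂_subset fun k _ => inter_subset_left))

end Arrangement

section Representatives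

variable {n : ℕ}

/-- `F` is a function on the whole space, vanishing outside the cube, that represents `q`. -/
structure IsRep (q : L1ModAffine n) (F : Euc n → ℝ) : Prop where
  integrable : Integrable F
  eq_zero : ∀ x, x ∉ cube n → F x = 0
  exists_eq : ∃ f : L1 n, proj n f = q ∧ f =ᵐ[volume.restrict (cube n)] F

theorem exists_isRep (q : L1ModAffine n) : ∃ F, IsRep q F := by
  obtain ⟨f, rfl⟩ := (affineFunctions n).mkQ_surjective q
  refine ⟨(cube n).indicator f, (integrable_indicator_iff (isOpen_cube n).measurableSet).mpr
    (L1.integrable_coeFn f), fun x hx => indicator_of_notMem hx _, f, rfl, ?_⟩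
  exact (indicator_ae_eq_restrict (isOpen_cube n).measurableSet).symm

namespace IsRep

variable {q q' : L1ModAffine n} {F F' : Euc n → ℝ}

theorem classVariation_eq (h : IsRep q F) {A : Set (Euc n)} (hA : IsOpen A) (hAc : A ⊆ cube n) :
    classVariation q A = variation F A := by
  obtain ⟨f, rfl, hf⟩ := h.exists_eq
  rw [classVariation_proj f hAc]
  refine variation_congr hA.measurableSet ?_
  filter_upwards [(ae_restrict_iff' (isOpen_cube n).measurableSet).mp hf] with x hx hxA
  exact hx (hAc hxA)

theorem add (h : IsRep q F) (h' : IsRep q' F') : IsRep (q + q') (F + F') := by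
  refine ⟨h.integrable.add h'.integrable, fun x hx => by
    simp [h.eq_zero x hx, h'.eq_zero x hx], ?_⟩
  obtain ⟨f, rfl, hf⟩ := h.exists_eq
  obtain ⟨f', rfl, hf'⟩ := h'.exists_eq
  exact ⟨f + f', map_add _ _ _, (Lp.coeFn_add f f').trans (hf.add hf')⟩

theorem smul (h : IsRep q F) (c : ℝ) : IsRep (c • q) (c • F) := by
  refine ⟨h.integrable.smul c, fun x hx => by simp [h.eq_zero x hx], ?_⟩
  obtain ⟨f, rfl, hf⟩ := h.exists_eq
  exact ⟨c • f, map_smul _ _ _, (Lp.coeFn_smul c f).trans (hf.const_smul c)⟩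

end IsRep

theorem classVariation_add_le (q q' : L1ModAffine n) {A : Set (Euc n)} (hA : IsOpen A)
    (hAc : A ⊆ cube n) :
    classVariation (q + q') A ≤ classVariation q A + classVariation q' A := by
  obtain ⟨F, hF⟩ := exists_isRep q
  obtain ⟨F', hF'⟩ := exists_isRep q'
  rw [(hF.add hF').classVariation_eq hA hAc, hF.classVariation_eq hA hAc,
    hF'.classVariation_eq hA hAc]
  exact variation_add_le hF.integrable hF'.integrable A

theorem classVariation_smul_le (c : ℝ) (q : L1ModAffine n) {A : Set (Euc n)} (hA : IsOpen A)
    (hAc : A ⊆ cube n) :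
    classVariation (c • q) A ≤ ENNReal.ofReal |c| * classVariation q A := by
  obtain ⟨F, hF⟩ := exists_isRep q
  rw [(hF.smul c).classVariation_eq hA hAc, hF.classVariation_eq hA hAc]
  exact variation_smul_le c F A

theorem classVariation_union_le (q : L1ModAffine n) {A B : Set (Euc n)} (hA : IsOpen A)
    (hAc : A ⊆ cube n) (hB : IsOpen B) (hBc : B ⊆ cube n) :
    classVariation q (A ∪ B) ≤ classVariation q A + classVariation q B := by
  obtain ⟨F, hF⟩ := exists_isRep q
  rw [hF.classVariation_eq (hA.union hB) (union_subset hAc hBc), hF.classVariation_eq hA hAc,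
    hF.classVariation_eq hB hBc]
  exact variation_union_le hF.integrable hA hB

theorem classVariation_add_classVariation_le (q : L1ModAffine n) {A B : Set (Euc n)}
    (hA : IsOpen A) (hAc : A ⊆ cube n) (hB : IsOpen B) (hBc : B ⊆ cube n) (hAB : Disjoint A B) :
    classVariation q A + classVariation q B ≤ classVariation q (cube n) := by
  obtain ⟨F, hF⟩ := exists_isRep q
  rw [hF.classVariation_eq (isOpen_cube n) Subset.rfl, hF.classVariation_eq hA hAc,
    hF.classVariation_eq hB hBc]
  exact (variation_add_variation_le hF.integrable hAB).trans
    (variation_mono F (union_subset hAc hBc))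

theorem classVariation_mono (q : L1ModAffine n) {A B : Set (Euc n)} (hA : IsOpen A)
    (hB : IsOpen B) (hBc : B ⊆ cube n) (hAB : A ⊆ B) :
    classVariation q A ≤ classVariation q B := by
  obtain ⟨F, hF⟩ := exists_isRep q
  rw [hF.classVariation_eq hA (hAB.trans hBc), hF.classVariation_eq hB hBc]
  exact variation_mono F hAB

theorem classVariation_zero : classVariation (0 : L1ModAffine n) (cube n) = 0 := by
  have := classVariation_smul_le (0 : ℝ) (0 : L1ModAffine n) (isOpen_cube n) Subset.rfl
  simpa using this

/-- On an open set, vanishing of the variation is inherited along inclusion of supports. -/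
theorem classVariation_eq_zero_of_hessianSupport_subset {g h : L1ModAffine n}
    (hs : hessianSupport h ⊆ hessianSupport g) {V : Set (Euc n)} (hV : IsOpen V)
    (hVc : V ⊆ cube n) (hg : classVariation g V = 0) : classVariation h V = 0 := by
  obtain ⟨F, hF⟩ := exists_isRep h
  rw [hF.classVariation_eq hV hVc]
  refine variation_eq_zero_of_locally hF.integrable fun x hx => ?_
  have hxg : x ∉ hessianSupport g := fun hx' => by
    have := hx'.2 V hV hVc hx
    simp [hg] at this
  have hxh : x ∉ hessianSupport h := fun hx' => hxg (hs hx')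
  by_contra! hne
  refine hxh ⟨hVc hx, fun A hA hAc hxA => ?_⟩
  rw [hF.classVariation_eq hA hAc]
  exact pos_iff_ne_zero.mpr (hne A hA hxA)

/-- The variation of the summands of a convex combination lying on the sphere is supported in the
support of the combination. -/
theorem hessianSupport_subset_of_convex_combination {a b : L1ModAffine n} (ha : a ∈ htvBall n)
    (hb : b ∈ htvBall n) {t s : ℝ} (ht : 0 < t) (hs : 0 < s) (hts : t + s = 1)
    (hg : t • a + s • b ∈ htvSphere n) :
    hessianSupport a ⊆ hessianSupport (t • a + s • b) := by
  intro x hx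
  by_contra hxg
  have hxc := hx.1
  have hA : ∃ A : Set (Euc n), IsOpen A ∧ A ⊆ cube n ∧ x ∈ A ∧
      classVariation (t • a + s • b) A = 0 := by
    by_contra! hne
    exact hxg ⟨hxc, fun A h1 h2 h3 => pos_iff_ne_zero.mpr (hne A h1 h2 h3)⟩
  obtain ⟨A, hA, hAc, hxA, h0⟩ := hA
  obtain ⟨r, hr, hrA⟩ := Metric.nhds_basis_closedBall.mem_iff.mp (hA.mem_nhds hxA)
  set V := cube n \ Metric.closedBall x r with hVdef
  have hV : IsOpen V := (isOpen_cube n).sdiff Metric.isClosed_closedBall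
  have hVc : V ⊆ cube n := sdiff_subset
  have hB : Metric.ball x r ⊆ cube n := (Metric.ball_subset_closedBall.trans hrA).trans hAc
  have hpos := hx.2 _ Metric.isOpen_ball hB (Metric.mem_ball_self hr)
  have hdis : Disjoint V (Metric.ball x r) :=
    disjoint_sdiff_left.mono_right Metric.ball_subset_closedBall
  have hcov : cube n = A ∪ V := by
    refine Subset.antisymm (fun y hy => ?_) (union_subset hAc hVc)
    by_cases hyr : y ∈ Metric.closedBall x r
    · exact Or.inl (hrA hyr)
    · exact Or.inr ⟨hy, hyr⟩
  have h1 : (1 : ℝ≥0∞) ≤ ENNReal.ofReal t * classVariation a V +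
      ENNReal.ofReal s * classVariation b V := by
    calc (1 : ℝ≥0∞) = classVariation (t • a + s • b) (A ∪ V) := by rw [← hcov]; exact hg.symm
      _ ≤ _ := classVariation_union_le _ hA hAc hV hVc
      _ = classVariation (t • a + s • b) V := by rw [h0, zero_add]
      _ ≤ _ := classVariation_add_le _ _ hV hVc
      _ ≤ _ := by
          refine add_le_add ((classVariation_smul_le t a hV hVc).trans_eq ?_)
            ((classVariation_smul_le s b hV hVc).trans_eq ?_)
          · rw [abs_of_pos ht]
          · rw [abs_of_pos hs]
  have h2 : classVariation a V + classVariation a (Metric.ball x r) ≤ 1 :=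
    (classVariation_add_classVariation_le a hV hVc Metric.isOpen_ball hB hdis).trans ha
  have h3 : classVariation b V ≤ 1 :=
    (classVariation_mono b hV (isOpen_cube n) Subset.rfl hVc).trans hb
  have h4 : classVariation a V < 1 := by
    refine lt_of_lt_of_le (ENNReal.lt_add_right ?_ hpos.ne') h2
    exact ne_top_of_le_ne_top ENNReal.one_ne_top (le_self_add.trans h2)
  have h5 : ENNReal.ofReal t * classVariation a V < ENNReal.ofReal t := by
    have := ENNReal.mul_lt_mul_right (ENNReal.ofReal_pos.mpr ht).ne' ENNReal.ofReal_ne_top h4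
    rwa [mul_one] at this
  have h6 : ENNReal.ofReal s * classVariation b V ≤ ENNReal.ofReal s := mul_le_of_le_one_right' h3
  have h7 : ENNReal.ofReal t * classVariation a V + ENNReal.ofReal s * classVariation b V < 1 := by
    calc _ < ENNReal.ofReal t + ENNReal.ofReal s :=
          ENNReal.add_lt_add_of_lt_of_le (ne_top_of_le_ne_top ENNReal.ofReal_ne_top h6) h5 h6
      _ = 1 := by rw [← ENNReal.ofReal_add ht.le hs.le, hts, ENNReal.ofReal_one]
  exact h1.not_gt h7

end Representatives

section Cube

theorem convex_cube (n : ℕ) : Convex ℝ (cube n) := by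
  intro x hx y hy a b ha hb hab i
  have := (convex_Ioo (0 : ℝ) 1) (hx i) (hy i) ha hb hab
  simpa using this

theorem isBounded_cube (n : ℕ) : Bornology.IsBounded (cube n) := by
  refine isBounded_iff_forall_norm_le.mpr ⟨n, fun x hx => ?_⟩
  rw [eq_sum_single x]
  refine (norm_sum_le _ _).trans ?_
  calc ∑ i, ‖x i • EuclideanSpace.single i (1 : ℝ)‖ ≤ ∑ _i : Fin n, (1 : ℝ) := by
        refine Finset.sum_le_sum fun i _ => ?_
        have := hx i
        rw [norm_smul, PiLp.norm_single, norm_one, mul_one, Real.norm_eq_abs, abs_of_pos this.1]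
        exact this.2.le
    _ = n := by simp

end Cube

section CPWL

variable {n : ℕ}

/-- A CPWL function on a bounded set takes everywhere the value of one of finitely many affine
functions. -/
theorem IsCPWL.exists_finset {O : Set (Euc n)} (hO : Bornology.IsBounded O) {φ : Euc n → ℝ}
    (h : IsCPWL O φ) : ∃ s : Finset (Euc n →ᵃ[ℝ] ℝ), ∀ x ∈ O, ∃ a ∈ s, φ x = a x := by
  classical
  obtain ⟨-, T, -, hcover, -, haff, hfin⟩ := h
  obtain ⟨r, hr⟩ := hO.subset_ball 0
  choose! a ha using haff
  refine ⟨(hfin 0 r).toFinset.image a, fun x hx => ?_⟩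
  obtain ⟨P, hP, hxP⟩ : x ∈ ⋃₀ T := hcover ▸ mem_univ x
  refine ⟨a P, Finset.mem_image_of_mem a ?_, ha P hP ⟨hxP, hx⟩⟩
  simpa using ⟨hP, x, hxP, hr hx⟩

/-- A continuous function taking values among finitely many affine functions is locally affine at
points where these are pairwise distinct. -/
theorem eventually_eq_affine {O : Set (Euc n)} (hO : IsOpen O) {φ : Euc n → ℝ}
    (hφ : ContinuousOn φ O) {s : Finset (Euc n →ᵃ[ℝ] ℝ)} (hs : ∀ x ∈ O, ∃ a ∈ s, φ x = a x)
    {x : Euc n} (hx : x ∈ O) (hne : ∀ a ∈ s, ∀ b ∈ s, a ≠ b → a x ≠ b x) :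
    ∃ a : Euc n →ᵃ[ℝ] ℝ, ∀ᶠ y in 𝓝 x, φ y = a y := by
  classical
  obtain ⟨a, ha, hax⟩ := hs x hx
  refine ⟨a, ?_⟩
  have hcont := hφ.continuousAt (hO.mem_nhds hx)
  have hev : ∀ b ∈ s.erase a, ∀ᶠ y in 𝓝 x, φ y ≠ b y := by
    intro b hb
    obtain ⟨hba, hb⟩ := Finset.mem_erase.mp hb
    have hx0 : φ x - b x ≠ 0 := by
      rw [hax]
      exact sub_ne_zero.mpr (hne a ha b hb (Ne.symm hba))
    filter_upwards [(hcont.sub b.continuous_of_finiteDimensional.continuousAt).eventually_ne hx0]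
      with y hy using sub_ne_zero.mp hy
  filter_upwards [(Filter.eventually_all_finset (s.erase a)).mpr hev, hO.mem_nhds hx] with y hy hyO
  obtain ⟨b, hb, hby⟩ := hs y hyO
  by_cases hba : b = a
  · rw [hby, hba]
  · exact absurd hby (hy b (Finset.mem_erase.mpr ⟨hba, hb⟩))

/-- The Hessian of a CPWL function lives on finitely many distinct hyperplanes. -/
theorem exists_arrangement {g : L1ModAffine n} (hg : g ∈ cpwlClasses n) :
    ∃ (H : Finset (Set (Euc n))) (ℓ : H → Euc n →ᵃ[ℝ] ℝ), (∀ i, (ℓ i).linear ≠ 0) ∧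
      (∀ i j, i ≠ j → {x | ℓ i x = 0} ≠ {x | ℓ j x = 0}) ∧
      classVariation g (offHyperplanes (cube n) ℓ) = 0 := by
  classical
  obtain ⟨f, ⟨φ, hφ, hfφ⟩, rfl⟩ := hg
  obtain ⟨s, hs⟩ := hφ.exists_finset (isBounded_cube n)
  set D : Finset (Euc n →ᵃ[ℝ] ℝ) :=
    (s.offDiag.image fun p => p.1 - p.2).filter fun d => d.linear ≠ 0 with hD
  set H : Finset (Set (Euc n)) := D.image fun d => {x | d x = 0} with hH
  have hrep : ∀ i : H, ∃ d : Euc n →ᵃ[ℝ] ℝ, d.linear ≠ 0 ∧ {x | d x = 0} = (i : Set (Euc n)) := by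
    rintro ⟨i, hi⟩
    obtain ⟨d, hd, rfl⟩ := Finset.mem_image.mp hi
    exact ⟨d, (Finset.mem_filter.mp hd).2, rfl⟩
  choose ℓ hℓ hℓH using hrep
  refine ⟨H, ℓ, hℓ, fun i j hij h => hij (Subtype.ext ?_), ?_⟩
  · rw [← hℓH i, ← hℓH j, h]
  have hopen : IsOpen (offHyperplanes (cube n) ℓ) := isOpen_offHyperplanes (isOpen_cube n)
  obtain ⟨F, hF⟩ := exists_isRep (proj n f)
  rw [hF.classVariation_eq hopen inter_subset_left]
  refine variation_eq_zero_of_locally hF.integrable fun x hx => ?_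
  obtain ⟨hxc, hxne⟩ := hx
  have hne : ∀ a ∈ s, ∀ b ∈ s, a ≠ b → a x ≠ b x := by
    intro a ha b hb hab hx
    by_cases hlin : (a - b).linear = 0
    · apply hab
      ext y
      have := (a - b).map_vadd x (y - x)
      rw [hlin] at this
      simp only [vadd_eq_add, sub_add_cancel, LinearMap.zero_apply, zero_add, AffineMap.coe_sub,
        Pi.sub_apply, hx, sub_self] at this
      linarith
    · have hmem : {y | (a - b) y = 0} ∈ H := Finset.mem_image.mpr ⟨a - b, Finset.mem_filter.mpr
        ⟨Finset.mem_image.mpr ⟨(a, b), Finset.mem_offDiag.mpr ⟨ha, hb, hab⟩, rfl⟩, hlin⟩, rfl⟩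
      have hxH : x ∈ {y | ℓ ⟨_, hmem⟩ y = 0} := by
        rw [hℓH]
        simp [hx]
      exact mem_iInter.mp hxne ⟨_, hmem⟩ hxH
  obtain ⟨a, ha⟩ := eventually_eq_affine (isOpen_cube n) hφ.1 hs hxc hne
  obtain ⟨V, hVa, hV, hxV⟩ := eventually_nhds_iff.mp ha
  refine ⟨V ∩ cube n, hV.inter (isOpen_cube n), ⟨hxV, hxc⟩, ?_⟩
  rw [← hF.classVariation_eq (hV.inter (isOpen_cube n)) inter_subset_right,
    classVariation_proj f inter_subset_right]
  refine variation_eq_zero_of_ae_eq_affine (hV.inter (isOpen_cube n)).measurableSet a ?_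
  filter_upwards [(ae_restrict_iff' (isOpen_cube n).measurableSet).mp hfφ] with y hy hyV
  rw [hy hyV.2, hVa y hyV.1]

end CPWL

section Extreme

variable {n : ℕ}

theorem smul_mem_htvBall_of_le {q : L1ModAffine n} {s : ℝ} (hs : 0 < s)
    (h : classVariation q (cube n) ≤ ENNReal.ofReal s) : s⁻¹ • q ∈ htvBall n := by
  refine (classVariation_smul_le s⁻¹ q (isOpen_cube n) Subset.rfl).trans ?_
  calc _ ≤ ENNReal.ofReal |s⁻¹| * ENNReal.ofReal s := by gcongr
    _ = 1 := by
        rw [← ENNReal.ofReal_mul (abs_nonneg _), abs_of_pos (inv_pos.mpr hs),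
          inv_mul_cancel₀ hs.ne', ENNReal.ofReal_one]

theorem le_one_of_smul_mem_htvBall {g : L1ModAffine n} (hg : g ∈ htvSphere n) {c : ℝ}
    (h : c • g ∈ htvBall n) : c ≤ 1 := by
  by_contra! hc
  have hc0 : 0 < c := one_pos.trans hc
  have h1 := classVariation_smul_le c⁻¹ (c • g) (isOpen_cube n) Subset.rfl
  rw [smul_smul, inv_mul_cancel₀ hc0.ne', one_smul, hg] at h1
  have h2 : (1 : ℝ≥0∞) ≤ ENNReal.ofReal |c⁻¹| :=
    h1.trans (mul_le_of_le_one_right' h)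
  rw [ENNReal.one_le_ofReal, abs_of_pos (inv_pos.mpr hc0)] at h2
  exact (inv_lt_one_of_one_lt₀ hc).not_ge h2

theorem mem_extremePoints_of_forall_mem_span {g : L1ModAffine n} (hg : g ∈ htvSphere n)
    (H : ∀ h ∈ htvBall n, hessianSupport h ⊆ hessianSupport g → h ∈ Submodule.span ℝ {g}) :
    g ∈ (htvBall n).extremePoints ℝ := by
  refine ⟨le_of_eq hg, ?_⟩
  rintro a ha b hb ⟨t, s, ht, hs, hts, rfl⟩
  obtain ⟨c, hc⟩ := Submodule.mem_span_singleton.mp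
    (H a ha (hessianSupport_subset_of_convex_combination ha hb ht hs hts hg))
  have hb' : hessianSupport b ⊆ hessianSupport (t • a + s • b) := by
    rw [add_comm] at hg ⊢
    exact hessianSupport_subset_of_convex_combination hb ha hs ht (by linarith) hg
  obtain ⟨d, hd⟩ := Submodule.mem_span_singleton.mp (H b hb hb')
  set g := t • a + s • b with hgdef
  have hg0 : g ≠ 0 := by
    intro h0
    have : classVariation g (cube n) = 1 := hg
    rw [h0, classVariation_zero] at this
    exact zero_ne_one this
  have hc1 : c ≤ 1 := le_one_of_smul_mem_htvBall hg (hc ▸ ha)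
  have hd1 : d ≤ 1 := le_one_of_smul_mem_htvBall hg (hd ▸ hb)
  have e : (t * c + s * d) • g = (1 : ℝ) • g := by
    rw [add_smul, mul_smul, mul_smul, hc, hd, one_smul]
  have e' : t * c + s * d = 1 := smul_left_injective ℝ hg0 e
  have : c = 1 := by nlinarith
  rw [← hc, this, one_smul]

theorem mem_span_of_mem_extremePoints {g : L1ModAffine n} (hg : g ∈ cpwlClasses n)
    (hgs : g ∈ htvSphere n) (hext : g ∈ (htvBall n).extremePoints ℝ) {h : L1ModAffine n}
    (hh : h ∈ htvBall n) (hs : hessianSupport h ⊆ hessianSupport g) :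
    h ∈ Submodule.span ℝ {g} := by
  classical
  obtain ⟨H, ℓ, hℓ, hd, h0⟩ := exists_arrangement hg
  obtain ⟨G, hG⟩ := exists_isRep g
  obtain ⟨F, hF⟩ := exists_isRep h
  have hO := isOpen_cube n
  have hg1 : classVariation g (cube n) = 1 := hgs
  have hh1 : classVariation h (cube n) ≤ 1 := hh
  obtain ⟨ε, hε, hε', hle⟩ := exists_variation_add_smul_le hO (convex_cube n) (isBounded_cube n)
    hℓ hd hF.integrable hG.integrable hF.eq_zero hG.eq_zero
    (by rw [← hF.classVariation_eq hO Subset.rfl]; exact ne_top_of_le_ne_top ENNReal.one_ne_top hh1)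
    (by rw [← hG.classVariation_eq hO Subset.rfl, hg1]; exact ENNReal.one_ne_top)
    (by rwa [← hG.classVariation_eq (isOpen_offHyperplanes hO) inter_subset_left])
    (fun V hV hVc hV0 => by
      rw [← hG.classVariation_eq hV hVc] at hV0
      rw [← hF.classVariation_eq hV hVc]
      exact classVariation_eq_zero_of_hessianSupport_subset hs hV hVc hV0)
  rw [← (hG.add (hF.smul ε)).classVariation_eq hO Subset.rfl,
    ← (hG.add (hF.smul (-ε))).classVariation_eq hO Subset.rfl,
    ← hG.classVariation_eq hO Subset.rfl, hg1, mul_one] at hle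
  have hfin1 : classVariation (g + ε • h) (cube n) ≠ ⊤ :=
    ne_top_of_le_ne_top ENNReal.ofNat_ne_top (le_self_add.trans hle)
  have hfin2 : classVariation (g + (-ε) • h) (cube n) ≠ ⊤ :=
    ne_top_of_le_ne_top ENNReal.ofNat_ne_top (le_add_self.trans hle)
  have hlow : ∀ c : ℝ, |c| ≤ 1 / 2 → classVariation (g + c • h) (cube n) ≠ ⊤ →
      1 / 2 ≤ (classVariation (g + c • h) (cube n)).toReal := by
    intro c hc hfin
    have e : g = (g + c • h) + (-c) • h := by rw [neg_smul]; abel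
    have h1 : (1 : ℝ≥0∞) ≤ classVariation (g + c • h) (cube n) + ENNReal.ofReal (1 / 2) := by
      calc (1 : ℝ≥0∞) = classVariation g (cube n) := hg1.symm
        _ = classVariation ((g + c • h) + (-c) • h) (cube n) := by rw [← e]
        _ ≤ _ := classVariation_add_le _ _ hO Subset.rfl
        _ ≤ _ := by
            gcongr
            refine (classVariation_smul_le (-c) h hO Subset.rfl).trans ?_
            refine (mul_le_of_le_one_right' hh1).trans ?_
            rw [abs_neg]
            exact ENNReal.ofReal_le_ofReal hc
    have h2 := ENNReal.toReal_mono (ENNReal.add_ne_top.mpr ⟨hfin, ENNReal.ofReal_ne_top⟩) h1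
    rw [ENNReal.toReal_add hfin ENNReal.ofReal_ne_top, ENNReal.toReal_ofReal (by norm_num)] at h2
    simp only [ENNReal.toReal_one] at h2
    linarith
  set s := (classVariation (g + ε • h) (cube n)).toReal with hsdef
  set s' := (classVariation (g + (-ε) • h) (cube n)).toReal with hs'def
  have hs1 : 1 / 2 ≤ s := hlow ε (by rwa [abs_of_pos hε]) hfin1
  have hs1' : 1 / 2 ≤ s' := hlow (-ε) (by rwa [abs_neg, abs_of_pos hε]) hfin2
  have hs2 : s + s' ≤ 2 := by
    have := ENNReal.toReal_mono ENNReal.ofNat_ne_top hle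
    rwa [ENNReal.toReal_add hfin1 hfin2, ENNReal.toReal_ofNat] at this
  have hu : s⁻¹ • (g + ε • h) ∈ htvBall n :=
    smul_mem_htvBall_of_le (by linarith) (ENNReal.ofReal_toReal hfin1).ge
  have hs3 : 0 < 2 - s := by linarith
  have hv : (2 - s)⁻¹ • (g + (-ε) • h) ∈ htvBall n := by
    refine smul_mem_htvBall_of_le hs3 ?_
    rw [← ENNReal.ofReal_toReal hfin2]
    exact ENNReal.ofReal_le_ofReal (by linarith)
  have hs0 : s ≠ 0 := by linarith
  have hseg : g ∈ openSegment ℝ (s⁻¹ • (g + ε • h)) ((2 - s)⁻¹ • (g + (-ε) • h)) := by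
    refine ⟨s / 2, (2 - s) / 2, by linarith, by linarith, by ring, ?_⟩
    have e1 : s / 2 * s⁻¹ = 1 / 2 := by field_simp
    have e2 : (2 - s) / 2 * (2 - s)⁻¹ = 1 / 2 := by field_simp
    rw [smul_smul, smul_smul, e1, e2, ← smul_add, neg_smul]
    have : g + ε • h + (g + -(ε • h)) = (2 : ℝ) • g := by
      rw [two_smul]
      abel
    rw [this, smul_smul]
    norm_num
  have heq : s⁻¹ • (g + ε • h) = g := hext.2 hu hv hseg
  have h2 : g + ε • h = s • g := by
    rw [← heq, smul_smul, mul_inv_cancel₀ hs0, one_smul, heq]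
  refine Submodule.mem_span_singleton.mpr ⟨ε⁻¹ * (s - 1), ?_⟩
  have h3 : ε • h = (s - 1) • g := by
    rw [sub_smul, one_smul, ← h2]
    abel
  rw [mul_smul, ← h3, smul_smul, inv_mul_cancel₀ hε.ne', one_smul]

end Extreme

end HTV

end

theorem proposition5p1 (n : ℕ) (g : HTV.L1ModAffine n)
    (hg : g ∈ HTV.cpwlClasses n ∩ HTV.htvSphere n) :
    g ∈ HTV.cpwlExtremePoints n ↔
      ∀ h ∈ HTV.htvBall n, HTV.hessianSupport h ⊆ HTV.hessianSupport g →
        h ∈ Submodule.span ℝ {g} := by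
  refine ⟨fun hext h hh hs => HTV.mem_span_of_mem_extremePoints hg.1 hg.2 hext.2 hh hs, fun H => ?_⟩
  exact ⟨hg.1, HTV.mem_extremePoints_of_forall_mem_span hg.2 H⟩
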